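/- Let $\mathbf{k}$ be a field and $V$ a $\mathbf{k}$-vector space with basis $\Omega$. **Conventions.** A dendriform trialgebra is a vector space with bilinear operations $\prec,\succ,\cdot$ satisfying, with $\star=\prec+\succ+\cdot$, $(x\prec y)\prec z=x\prec(y\star z)$, $(x\succ y)\prec z=x\succ(y\prec z)$, $(x\star y)\succ z=x\succ(y\succ z)$, $(x\succ y)\cdot z=x\succ(y\cdot z)$, $(x\prec y)\cdot z=x\cdot(y\succ z)$, $(x\cdot y)\prec z=x\cdot(y\prec z)$, $(x\cdot y)\cdot z=x\cdot(y\cdot z)$. A nonunitary Rota-Baxter algebra of weight $\lambda$ is a nonunitary associative $\mathbf{k}$-algebra $A$ with a linear operator $R$ such that $R(x)R(y)=R(R(x)y+xR(y)+\lambda xy)$; it carries the operations $x\prec_R y=xR(y)$, $x\succ_R y=R(x)y$, $x\cdot_R y=\lambda xy$. *Trees.* Let $\mathrm{DT}(V)$ be the vector space with basis all planar rooted trees other than the one-leaf tree $|$, in which every internal vertex has at least two children and a vertex with $n+1$ children is decorated by an element of $\Omega^{n}$. Every such tree is uniquely a grafting $T=T^{(0)}\vee_{x_1}\cdots\vee_{x_m}T^{(m)}$,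 $m\ge1$, of trees (possibly $|$). For this $T$ and $U=U^{(0)}\vee_{y_1}\cdots\vee_{y_n}U^{(n)}$ put, recursively, $$T\prec U=T^{(0)}\vee_{x_1}\cdots\vee_{x_m}(T^{(m)}\star U),\qquad T\succ U=(T\star U^{(0)})\vee_{y_1}\cdots\vee_{y_n}U^{(n)},$$ $$T\cdot U=T^{(0)}\vee_{x_1}\cdots\vee_{x_m}(T^{(m)}\star U^{(0)})\vee_{y_1}\cdots\vee_{y_n}U^{(n)},$$ where $\star=\prec+\succ+\cdot$, $|\star S=S\star|=S$ for every tree $S$, and grafting is extended linearly in each branch. Let $V\to \mathrm{DT}(V)$ be the linear map $x\mapsto|\vee_x|$ ($x\in\Omega$). *Words.* Let $T(V)=\bigoplus_{n\ge1}V^{\otimes n}$, with basis $X=M(\Omega)$, the free semigroup on $\Omega$. Let $\mathfrak X_\infty$ be the set of Rota-Baxter words on $X$: nonempty words whose letters are alternately elements of $X$ and brackets $\lfloor u\rfloor$ with $u\in\mathfrak X_\infty$. Let $Ш(T(V))$ be the vector space with basis $\mathfrak X_\infty$, with the operator $R(u)=\lfloor u\rfloor$ and the bilinear product $\diamond$ given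 on words by $p_1\cdots p_b\diamond q_1\cdots q_c=p_1\cdots p_{b-1}(p_b\diamond q_1)q_2\cdots q_c$, where $p_b\diamond q_1$ is the product in $T(V)$ if both lie in $X$, is the concatenation if exactly one lies in $X$, and $\lfloor u\rfloor\diamond\lfloor v\rfloor=\lfloor\lfloor u\rfloor\diamond v\rfloor+\lfloor u\diamond\lfloor v\rfloor\rfloor+\lfloor u\diamond v\rfloor$. Let $j_{T(V)}:T(V)\to Ш(T(V))$ be the linear map sending $x\in X$ to the one-letter word $x$, and $j$ its restriction to $V$. Define a linear map $\psi:\mathrm{DT}(V)\to Ш(T(V))$ recursively by $$\psi(T^{(0)}\vee_{x_1}\cdots\vee_{x_m}T^{(m)})=\lfloor\psi(T^{(0)})\rfloor x_1\lfloor\psi(T^{(1)})\rfloor x_2\cdots x_m\lfloor\psi(T^{(m)})\rfloor,$$ where, if $T^{(i)}=|$, the factor $\lfloor\psi(T^{(i)})\rfloor$ is dropped when $i=0$ or $i=m$, and is replaced by $\otimes$ when $0<i<m$. A word of $\mathfrak X_\infty$ is a dendriform triword if it is not of the form $\lfloor u\rfloor$ and has no subword $\lfloor\lfloor u\rfloor\rfloor$,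 with $u\in\mathfrak X_\infty$. **Theorem.** 1. $\mathrm{DT}(V)$, with $V\to\mathrm{DT}(V)$, is the free dendriform trialgebra over $V$. 2. $Ш(T(V))$, with $\diamond$, $R$ and $j_{T(V)}$, is the free nonunitary Rota-Baxter algebra of weight one over the nonunitary algebra $T(V)$; in particular it is a dendriform trialgebra under $\prec_R,\succ_R,\cdot_R$ (with $\lambda=1$). 3. $\psi:\mathrm{DT}(V)\to Ш(T(V))$ is a morphism of dendriform trialgebras. 4. $\psi$ is the morphism induced by $j$: the composite $V\to\mathrm{DT}(V)\xrightarrow{\psi}Ш(T(V))$ is $j$, and $\psi$ is the only morphism of dendriform trialgebras with this property. 5. The image of $\psi$ is the linear span of the dendriform triwords. 6. $\psi$ is injective. So the free dendriform trialgebra over $V$ is a canonical sub-trialgebra of the free Rota-Baxter algebra $Ш(T(V))$ of weight one. -/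

import Mathlib

universe u v w

namespace DendRB

open Module

noncomputable section

/-! ## Dendriform trialgebras and Rota-Baxter algebras -/

/-- The data of three bilinear operations `≺`, `≻`, `·` on a module. -/
structure TriOps (k : Type u) (D : Type v) [Field k] [AddCommGroup D] [Module k D] where
  prec : D →ₗ[k] D →ₗ[k] D
  succ : D →ₗ[k] D →ₗ[k] D
  dot : D →ₗ[k] D →ₗ[k] D

namespace TriOps

variable {k : Type*} [Field k]
variable {D : Type*} [AddCommGroup D] [Module k D]
variable {E : Type*} [AddCommGroup E] [Module k E]
variable {V : Type*} [AddCommGroup V] [Module k V]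

/-- `⋆ = ≺ + ≻ + ·`. -/
def star (o : TriOps k D) : D →ₗ[k] D →ₗ[k] D := o.prec + o.succ + o.dot

/-- The seven axioms of a dendriform trialgebra. -/
structure IsDendriform (o : TriOps k D) : Prop where
  prec_prec : ∀ x y z, o.prec (o.prec x y) z = o.prec x (o.star y z)
  succ_prec : ∀ x y z, o.prec (o.succ x y) z = o.succ x (o.prec y z)
  star_succ : ∀ x y z, o.succ (o.star x y) z = o.succ x (o.succ y z)
  succ_dot : ∀ x y z, o.dot (o.succ x y) z = o.succ x (o.dot y z)
  prec_dot : ∀ x y z, o.dot (o.prec x y) z = o.dot x (o.succ y z)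
  dot_prec : ∀ x y z, o.prec (o.dot x y) z = o.dot x (o.prec y z)
  dot_dot : ∀ x y z, o.dot (o.dot x y) z = o.dot x (o.dot y z)

/-- Morphisms of dendriform trialgebras: linear maps preserving the three operations. -/
structure IsHom (o : TriOps k D) (o' : TriOps k E) (f : D →ₗ[k] E) : Prop where
  map_prec : ∀ x y, f (o.prec x y) = o'.prec (f x) (f y)
  map_succ : ∀ x y, f (o.succ x y) = o'.succ (f x) (f y)
  map_dot : ∀ x y, f (o.dot x y) = o'.dot (f x) (f y)

/-- `(D, o)` with `i : V → D` is a free dendriform trialgebra over the vector space `V`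
(the universal property being tested on trialgebras in the universe `w`). -/
def IsFree (o : TriOps k D) (i : V →ₗ[k] D) : Prop :=
  o.IsDendriform ∧
    ∀ (E : Type w) [AddCommGroup E] [Module k E] (o' : TriOps k E), o'.IsDendriform →
      ∀ f : V →ₗ[k] E, ∃! g : D →ₗ[k] E, o.IsHom o' g ∧ g ∘ₗ i = f

end TriOps

/-- The data of a bilinear product and a linear operator on a module. -/
structure RBOps (k : Type u) (A : Type v) [Field k] [AddCommGroup A] [Module k A] where
  mul : A →ₗ[k] A →ₗ[k] A
  R : A →ₗ[k] A

namespace RBOps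

variable {k : Type*} [Field k]
variable {A : Type*} [AddCommGroup A] [Module k A]
variable {A' : Type*} [AddCommGroup A'] [Module k A']
variable {B : Type*} [NonUnitalRing B] [Module k B]

/-- Nonunitary Rota-Baxter algebras of weight `wt`: the product is associative and
`R(x) R(y) = R(R(x) y + x R(y) + wt x y)`. -/
structure IsRotaBaxter (o : RBOps k A) (wt : k) : Prop where
  assoc : ∀ x y z, o.mul (o.mul x y) z = o.mul x (o.mul y z)
  rota_baxter : ∀ x y,
    o.mul (o.R x) (o.R y) = o.R (o.mul (o.R x) y + o.mul x (o.R y) + wt • o.mul x y)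

/-- Morphisms of nonunitary Rota-Baxter algebras. -/
structure IsHom (o : RBOps k A) (o' : RBOps k A') (f : A →ₗ[k] A') : Prop where
  map_mul : ∀ x y, f (o.mul x y) = o'.mul (f x) (f y)
  map_R : ∀ x, f (o.R x) = o'.R (f x)

/-- A linear map from a nonunitary algebra `B` that is an algebra homomorphism. -/
def IsAlgHom (o : RBOps k A) (f : B →ₗ[k] A) : Prop :=
  ∀ x y, f (x * y) = o.mul (f x) (f y)

/-- `(A, o)` with `j : B → A` is a free nonunitary Rota-Baxter algebra of weight `wt` over the
nonunitary algebra `B` (the universal property being tested on Rota-Baxter algebras in the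
universe `w`). -/
def IsFree (o : RBOps k A) (wt : k) (j : B →ₗ[k] A) : Prop :=
  o.IsRotaBaxter wt ∧ o.IsAlgHom j ∧
    ∀ (A' : Type w) [AddCommGroup A'] [Module k A'] (o' : RBOps k A'), o'.IsRotaBaxter wt →
      ∀ f : B →ₗ[k] A', o'.IsAlgHom f →
        ∃! g : A →ₗ[k] A', o.IsHom o' g ∧ g ∘ₗ j = f

/-- The operations `x ≺ y = x R(y)`, `x ≻ y = R(x) y`, `x · y = wt x y` of a Rota-Baxter algebra
of weight `wt`. -/
def toTri (o : RBOps k A) (wt : k) : TriOps k A where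
  prec := o.mul.compl₂ o.R
  succ := o.mul ∘ₗ o.R
  dot := wt • o.mul

end RBOps

/-! ## Bilinear extension of an operation defined on bases -/

/-- The bilinear extension of `f : α × β → k[γ]`. -/
def bilin (k : Type*) [Field k] {α β γ : Type*} (f : α → β → (γ →₀ k)) :
    (α →₀ k) →ₗ[k] (β →₀ k) →ₗ[k] (γ →₀ k) :=
  Finsupp.linearCombination k fun a => Finsupp.linearCombination k (f a)

/-! ## The free Rota-Baxter algebra on an algebra with a basis -/

/-- Rota-Baxter bracketed words on the alphabet `X`: nonempty words whose letters are alternately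
an element of `X` or a bracket `⌊u⌋` enclosing another such word `u`.  The index is the head:
`false` if the first letter is in `X`, `true` if it is a bracket. -/
inductive Word (X : Type u) : Bool → Type u
  /-- the word `x` -/
  | letter (x : X) : Word X false
  /-- the word `⌊u⌋` -/
  | bracket {h : Bool} (u : Word X h) : Word X true
  /-- the word `x z`, where `z` starts with a bracket -/
  | letterCons (x : X) (z : Word X true) : Word X false
  /-- the word `⌊u⌋ z`, where `z` starts with an element of `X` -/
  | bracketCons {h : Bool} (u : Word X h) (z : Word X false) : Word X true

/-- The set of all Rota-Baxter words on `X`. -/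
abbrev RBWord (X : Type u) : Type u := Σ h : Bool, Word X h

namespace Word

variable {X : Type*}

/-- A measure of the size of a word, used for recursion. -/
def size : {h : Bool} → Word X h → ℕ
  | _, letter _ => 1
  | _, bracket u => u.size + 1
  | _, letterCons _ z => z.size + 1
  | _, bracketCons u z => u.size + z.size + 1

/-- The word is of the form `⌊u⌋`. -/
def IsBracket : {h : Bool} → Word X h → Prop
  | _, bracket _ => True
  | _, _ => False

/-- The word has no subword of the form `⌊⌊u⌋⌋`. -/
def NoDouble : {h : Bool} → Word X h → Prop
  | _, letter _ => True
  | _, bracket u => ¬ u.IsBracket ∧ u.NoDouble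
  | _, letterCons _ z => z.NoDouble
  | _, bracketCons u z => ¬ u.IsBracket ∧ u.NoDouble ∧ z.NoDouble

/-- Dendriform triwords: the word is not of the form `⌊u⌋`, and has no subword `⌊⌊u⌋⌋`. -/
def IsTriword {h : Bool} (z : Word X h) : Prop := ¬ z.IsBracket ∧ z.NoDouble

end Word

section Sha

variable {k : Type*} [Field k] {B : Type*} [NonUnitalRing B] [Module k B]
variable {X : Type*}

open Word in
/-- The product `⋄` of two Rota-Baxter words on a basis `X` of the algebra `B`, as a combination
of words: concatenation, except that adjacent letters in `X` are multiplied in `B`, and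
`⌊u⌋ ⋄ ⌊v⌋ = ⌊⌊u⌋ ⋄ v⌋ + ⌊u ⋄ ⌊v⌋⌋ + wt ⌊u ⋄ v⌋`.  The words of `p ⋄ q` have the head of `p`. -/
def mulWord (e : Basis X k B) (wt : k) : {h h' : Bool} → Word X h → Word X h' → (Word X h →₀ k)
  | _, _, letterCons x z, q => (mulWord e wt z q).mapDomain (letterCons x)
  | _, _, bracketCons u z, q => (mulWord e wt z q).mapDomain (bracketCons u)
  | _, _, letter x, letter y => (e.repr (e x * e y)).mapDomain letter
  | _, _, letter x, letterCons y q => (e.repr (e x * e y)).mapDomain fun a => letterCons a q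
  | _, _, letter x, bracket v => Finsupp.single (letterCons x (bracket v)) 1
  | _, _, letter x, bracketCons v q => Finsupp.single (letterCons x (bracketCons v q)) 1
  | _, _, bracket u, letter y => Finsupp.single (bracketCons u (letter y)) 1
  | _, _, bracket u, letterCons y q => Finsupp.single (bracketCons u (letterCons y q)) 1
  | _, _, bracket u, bracket v =>
      (mulWord e wt (bracket u) v).mapDomain bracket
        + (mulWord e wt u (bracket v)).mapDomain bracket
        + wt • (mulWord e wt u v).mapDomain bracket
  | _, _, bracket u, bracketCons v q =>
      (mulWord e wt (bracket u) v).mapDomain (fun a => bracketCons a q)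
        + (mulWord e wt u (bracket v)).mapDomain (fun a => bracketCons a q)
        + wt • (mulWord e wt u v).mapDomain (fun a => bracketCons a q)
termination_by _ _ p q => p.size + q.size
decreasing_by all_goals (simp only [Word.size]; omega)

/-- The vector space with basis the Rota-Baxter words on `X`. -/
abbrev Sha (k : Type*) [Field k] (X : Type*) : Type _ := RBWord X →₀ k

/-- The product `⋄` and the operator `R(u) = ⌊u⌋` on `Sha k X`, for the algebra `B` with
basis `X`. -/
def shaOps (e : Basis X k B) (wt : k) : RBOps k (Sha k X) where
  mul := bilin k fun p q : RBWord X => (mulWord e wt p.2 q.2).mapDomain (Sigma.mk p.1)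
  R := Finsupp.lmapDomain k k fun p : RBWord X => ⟨true, Word.bracket p.2⟩

/-- The map `j_B : B → Ш(B)` sending a basis element `x` to the one-letter word `x`. -/
def shaIncl (e : Basis X k B) : B →ₗ[k] Sha k X :=
  Finsupp.lmapDomain k k (fun x => (⟨false, Word.letter x⟩ : RBWord X)) ∘ₗ e.repr.toLinearMap

end Sha

/-! ## The nonunitary tensor algebra -/

section Tensor

variable {k : Type*} [Field k] {V : Type*} [AddCommGroup V] [Module k V] {Ω : Type*}

/-- The nonunitary tensor algebra `T(V) = ⨁_{n ≥ 1} V^{⊗ n}`: the nonunitary subalgebra of the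
tensor algebra generated by `V`. -/
abbrev TPos (k : Type*) [Field k] (V : Type*) [AddCommGroup V] [Module k V] : Type _ :=
  NonUnitalAlgebra.adjoin k (Set.range (TensorAlgebra.ι k : V → TensorAlgebra k V))

/-- The inclusion `V → T(V)`. -/
def tposIncl (k : Type*) [Field k] (V : Type*) [AddCommGroup V] [Module k V] :
    V →ₗ[k] TPos k V where
  toFun v := ⟨TensorAlgebra.ι k v, NonUnitalAlgebra.subset_adjoin k ⟨v, rfl⟩⟩
  map_add' _ _ := Subtype.ext (map_add _ _ _)
  map_smul' _ _ := Subtype.ext (map_smul _ _ _)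

/-- The pure tensor `x₁ ⊗ ⋯ ⊗ xₙ` in `T(V)` of a word `x₁ ⋯ xₙ` on the basis `Ω` of `V`. -/
def pureTensor (b : Basis Ω k V) : FreeSemigroup Ω →ₙ* TPos k V :=
  FreeSemigroup.lift fun x => tposIncl k V (b x)

theorem coe_pureTensor (b : Basis Ω k V) (s : FreeSemigroup Ω) :
    (pureTensor b s : TensorAlgebra k V) =
      b.tensorAlgebra (FreeMonoid.ofList (s.head :: s.tail)) := by
  have key : ∀ m : FreeMonoid Ω, b.tensorAlgebra m =
      FreeMonoid.lift (fun x => TensorAlgebra.ι k (b x)) m := by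
    intro m
    induction m using FreeMonoid.inductionOn' with
    | one =>
      simp [Basis.tensorAlgebra, FreeAlgebra.basisFreeMonoid,
        FreeAlgebra.equivMonoidAlgebraFreeMonoid]
    | of_mul x m ih =>
      rw [map_mul (FreeMonoid.lift fun x => TensorAlgebra.ι k (b x)), ← ih,
        FreeMonoid.lift_eval_of]
      simp [Basis.tensorAlgebra, FreeAlgebra.basisFreeMonoid,
        FreeAlgebra.equivMonoidAlgebraFreeMonoid]
  rw [key]
  induction s using FreeSemigroup.recOnMul with
  | ih1 x =>
    change TensorAlgebra.ι k (b x) = _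
    simp
  | ih2 x y _ ih =>
    rw [map_mul]
    change TensorAlgebra.ι k (b x) * (pureTensor b y : TensorAlgebra k V) = _
    rw [ih]
    change _ = FreeMonoid.lift _ (FreeMonoid.of x * FreeMonoid.ofList (y.head :: y.tail))
    rw [map_mul, FreeMonoid.lift_eval_of]

theorem pureTensor_linearIndependent (b : Basis Ω k V) :
    LinearIndependent k (pureTensor b) := by
  have inj : Function.Injective
      (fun s : FreeSemigroup Ω => FreeMonoid.ofList (s.head :: s.tail)) := by
    intro s t h
    have h' : s.head :: s.tail = t.head :: t.tail := FreeMonoid.ofList.injective h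
    exact FreeSemigroup.ext (List.cons.inj h').1 (List.cons.inj h').2
  have h := b.tensorAlgebra.linearIndependent.comp _ inj
  refine LinearIndependent.of_comp
    (NonUnitalSubalgebra.toSubmodule (NonUnitalAlgebra.adjoin k
      (Set.range (TensorAlgebra.ι k : V → TensorAlgebra k V)))).subtype ?_
  have e : (fun s => (pureTensor b s : TensorAlgebra k V)) =
      b.tensorAlgebra ∘ fun s : FreeSemigroup Ω => FreeMonoid.ofList (s.head :: s.tail) :=
    funext fun s => coe_pureTensor b s
  rw [← e] at h
  exact h

theorem pureTensor_span (b : Basis Ω k V) :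
    ⊤ ≤ Submodule.span k (Set.range (pureTensor b)) := by
  rintro ⟨a, ha⟩ -
  induction ha using NonUnitalAlgebra.adjoin_induction with
  | mem x hx =>
    obtain ⟨v, rfl⟩ := hx
    change tposIncl k V v ∈ _
    rw [← b.linearCombination_repr v, Finsupp.linearCombination_apply, Finsupp.sum, map_sum]
    refine Submodule.sum_mem _ fun i _ => ?_
    rw [map_smul]
    exact Submodule.smul_mem _ _ (Submodule.subset_span ⟨FreeSemigroup.of i, rfl⟩)
  | zero => exact Submodule.zero_mem _
  | add x y hx hy h1 h2 => exact Submodule.add_mem _ h1 h2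
  | smul r x hx h => exact Submodule.smul_mem _ r h
  | mul x y hx hy h1 h2 =>
    change (⟨x, hx⟩ * ⟨y, hy⟩ : TPos k V) ∈ _
    generalize (⟨x, hx⟩ : TPos k V) = x at h1
    generalize (⟨y, hy⟩ : TPos k V) = y at h2
    induction h1 using Submodule.span_induction with
    | zero => simp
    | add p q _ _ hp hq => rw [add_mul]; exact Submodule.add_mem _ hp hq
    | smul r p _ hp => rw [smul_mul_assoc]; exact Submodule.smul_mem _ r hp
    | mem p hp =>
      obtain ⟨s, rfl⟩ := hp
      induction h2 using Submodule.span_induction with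
      | zero => simp
      | add p q _ _ hp hq => rw [mul_add]; exact Submodule.add_mem _ hp hq
      | smul r p _ hp => rw [mul_smul_comm]; exact Submodule.smul_mem _ r hp
      | mem p hp =>
        obtain ⟨t, rfl⟩ := hp
        rw [← map_mul]
        exact Submodule.subset_span ⟨s * t, rfl⟩

/-- The basis `M(Ω)` (the free semigroup on `Ω`) of `T(V)` given by a basis `Ω` of `V`. -/
def tposBasis (b : Basis Ω k V) : Basis (FreeSemigroup Ω) k (TPos k V) :=
  Basis.mk (pureTensor_linearIndependent b) (pureTensor_span b)

end Tensor

/-! ## Valently decorated planar trees -/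

mutual
/-- Planar trees whose internal vertices have at least two children, valently decorated by `Ω`:
a vertex with `n + 1` children is decorated by an `n`-tuple of elements of `Ω`. -/
inductive Tree (Ω : Type u) : Type u
  /-- the tree `|` with one leaf -/
  | leaf : Tree Ω
  /-- a tree other than `|` -/
  | node (t : Node Ω) : Tree Ω
/-- The decorated trees `T₀ ∨_{x₁} T₁ ∨_{x₂} ⋯ ∨_{xₙ} Tₙ`, `n ≥ 1`, other than `|`. -/
inductive Node (Ω : Type u) : Type u
  /-- `two T₀ x T₁` is the grafting `T₀ ∨_x T₁` -/
  | two (l : Tree Ω) (x : Ω) (r : Tree Ω) : Node Ω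
  /-- for `t = T₁ ∨_{x₂} ⋯ ∨_{xₙ} Tₙ`, `cons T₀ x₁ t` is the grafting
  `T₀ ∨_{x₁} T₁ ∨_{x₂} ⋯ ∨_{xₙ} Tₙ` with a single root vertex -/
  | cons (l : Tree Ω) (x : Ω) (t : Node Ω) : Node Ω
end

namespace Node

variable {Ω : Type*}

/-- The first branch `T₀` of the root. -/
def first : Node Ω → Tree Ω
  | two l _ _ => l
  | cons l _ _ => l

/-- The last branch `Tₙ` of the root. -/
def last : Node Ω → Tree Ω
  | two _ _ r => r
  | cons _ _ t => t.last

/-- Replace the first branch of the root by `S`. -/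
def setFirst (S : Tree Ω) : Node Ω → Node Ω
  | two _ x r => two S x r
  | cons _ x t => cons S x t

/-- Replace the last branch of the root by `S`. -/
def setLast (S : Tree Ω) : Node Ω → Node Ω
  | two l x _ => two l x S
  | cons l x t => cons l x (t.setLast S)

/-- `fuse T S U` is `T₀ ∨_{x₁} ⋯ ∨_{xₘ} S ∨_{y₁} U₁ ∨ ⋯ ∨_{yₙ} Uₙ`: the last branch of `T` and the
first branch of `U` are replaced by one common branch `S`. -/
def fuse (S : Tree Ω) (U : Node Ω) : Node Ω → Node Ω
  | two l x _ => cons l x (U.setFirst S)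
  | cons l x t => cons l x (fuse S U t)

end Node

mutual
/-- The number of elements of `Ω` in the decorations (one less than the number of leaves). -/
def Tree.size {Ω : Type*} : Tree Ω → ℕ
  | .leaf => 0
  | .node t => t.size
/-- The number of elements of `Ω` in the decorations (one less than the number of leaves). -/
def Node.size {Ω : Type*} : Node Ω → ℕ
  | .two l _ r => l.size + 1 + r.size
  | .cons l _ t => l.size + 1 + t.size
end

theorem Node.size_first_lt {Ω : Type*} (t : Node Ω) : t.first.size < t.size := by
  cases t <;> simp only [Node.first, Node.size] <;> omega

theorem Node.size_last_lt {Ω : Type*} : (t : Node Ω) → t.last.size < t.size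
  | .two _ _ _ => by simp only [Node.last, Node.size]; omega
  | .cons _ _ t => by
      have := Node.size_last_lt t
      simp only [Node.last, Node.size]; omega

section DT

variable {Ω : Type*}

/-- The operation `⋆ = ≺ + ≻ + ·` on trees, with `| ⋆ T = T ⋆ | = T`, as a combination of trees;
the three summands in the last case are `T ≺ U`, `T ≻ U` and `T · U`. -/
def starTree (k : Type*) [Field k] : Tree Ω → Tree Ω → (Tree Ω →₀ k)
  | .leaf, U => Finsupp.single U 1
  | .node t, .leaf => Finsupp.single (.node t) 1
  | .node t, .node s =>
      (starTree k t.last (.node s)).mapDomain (fun S => .node (t.setLast S))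
        + (starTree k (.node t) s.first).mapDomain (fun S => .node (s.setFirst S))
        + (starTree k t.last s.first).mapDomain (fun S => .node (Node.fuse S s t))
termination_by T U => T.size + U.size
decreasing_by
  all_goals
    have h1 := t.size_last_lt
    have h2 := s.size_first_lt
    simp only [Tree.size]
    omega

/-- The vector space with basis the decorated trees other than `|`. -/
abbrev DT (k : Type*) [Field k] (Ω : Type*) : Type _ := Node Ω →₀ k

/-- The operations of the dendriform trialgebra of decorated trees.  With
`T = T₀ ∨_{x₁} ⋯ ∨_{xₘ} Tₘ` and `U = U₀ ∨_{y₁} ⋯ ∨_{yₙ} Uₙ`,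
`T ≺ U = T₀ ∨ ⋯ ∨_{xₘ} (Tₘ ⋆ U)`, `T ≻ U = (T ⋆ U₀) ∨_{y₁} ⋯ ∨ Uₙ` and
`T · U = T₀ ∨ ⋯ ∨_{xₘ} (Tₘ ⋆ U₀) ∨_{y₁} ⋯ ∨ Uₙ`. -/
def dtOps (k : Type*) [Field k] (Ω : Type*) : TriOps k (DT k Ω) where
  prec := bilin k fun t s => (starTree k t.last (.node s)).mapDomain fun S => t.setLast S
  succ := bilin k fun t s => (starTree k (.node t) s.first).mapDomain fun S => s.setFirst S
  dot := bilin k fun t s => (starTree k t.last s.first).mapDomain fun S => Node.fuse S s t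

/-- The map `V → DT(V)` sending a basis element `x` to the tree `| ∨_x |`. -/
def dtIncl {k : Type*} [Field k] {V : Type*} [AddCommGroup V] [Module k V] (b : Basis Ω k V) :
    V →ₗ[k] DT k Ω :=
  Finsupp.lmapDomain k k (fun x => Node.two .leaf x .leaf) ∘ₗ b.repr.toLinearMap

end DT

/-! ## The map `ψ` -/

section Psi

variable {Ω : Type*}

/-- Put the letter `x` in front of a word on `M(Ω)`: if the word starts with a letter `y` the
result starts with the letter `x ⊗ y`, otherwise `x` becomes a new first letter. -/
def prepend (x : Ω) : {h : Bool} → Word (FreeSemigroup Ω) h → Word (FreeSemigroup Ω) false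
  | _, .letter y => .letter (FreeSemigroup.of x * y)
  | _, .letterCons y z => .letterCons (FreeSemigroup.of x * y) z
  | _, .bracket u => .letterCons (FreeSemigroup.of x) (.bracket u)
  | _, .bracketCons u z => .letterCons (FreeSemigroup.of x) (.bracketCons u z)

/-- Put `⌊p⌋` in front of a word starting with a letter; nothing if `p` is absent. -/
def prependBracket {X : Type*} : Option (RBWord X) → Word X false → RBWord X
  | none, z => ⟨false, z⟩
  | some p, z => ⟨true, .bracketCons p.2 z⟩

/-- The word `x ⌊p⌋`; the word `x` if `p` is absent. -/
def appendBracket {X : Type*} (x : X) : Option (RBWord X) → Word X false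
  | none => .letter x
  | some p => .letterCons x (.bracket p.2)

mutual
/-- `psiNode T` is the word `⌊ψ(T₀)⌋ x₁ ⌊ψ(T₁)⌋ ⋯ xₙ ⌊ψ(Tₙ)⌋`, where for `Tᵢ = |` the factor
`⌊ψ(Tᵢ)⌋` is dropped if `i = 0` or `i = n` and replaced by `⊗` if `0 < i < n`. -/
def psiNode : Node Ω → RBWord (FreeSemigroup Ω)
  | .two l x r => prependBracket (psiTree l) (appendBracket (FreeSemigroup.of x) (psiTree r))
  | .cons l x t => prependBracket (psiTree l) (prepend x (psiNode t).2)
/-- The word `ψ(T)`, absent for `T = |`. -/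
def psiTree : Tree Ω → Option (RBWord (FreeSemigroup Ω))
  | .leaf => none
  | .node t => some (psiNode t)
end

/-- The linear map `ψ : DT(V) → Ш(T(V))`. -/
def psi (k : Type*) [Field k] (Ω : Type*) : DT k Ω →ₗ[k] Sha k (FreeSemigroup Ω) :=
  Finsupp.lmapDomain k k psiNode

/-- The span `TW(V)` of the dendriform triwords. -/
def triwordSpan (k : Type*) [Field k] (X : Type*) : Submodule k (Sha k X) :=
  Submodule.span k {a | ∃ p : RBWord X, p.2.IsTriword ∧ a = Finsupp.single p 1}

end Psi

end

end DendRB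

/-!
The product `⋄` of `Ш(B)` is associative because any triple of words reduces, by splitting off
first factors, to triples of letters and brackets.  The only triple for which neither concatenation
nor associativity of `B` suffices is `(⌊u⌋, ⌊v⌋, ⌊w⌋)`; there the Rota-Baxter identity expands both
sides into products of triples with fewer brackets, and one argues by recursion.  Words being
products of letters and brackets, a morphism from `Ш(B)` is determined on `B`, and its values on
words can be prescribed by recursion.

A tree `T₀ ∨_{x₁} ⋯ ∨_{xₙ} Tₙ` is `(T₀ ≻ x₁) · (T₁ ≻ x₂) · ⋯ · (Tₙ₋₁ ≻ xₙ) ≺ Tₙ`, so its image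
under a morphism is forced; conversely evaluating this expression in a dendriform trialgebra defines
a linear map on `DT(V)` which the seven axioms show to be a morphism.  For the trialgebra `Ш(T(V))`
this evaluation is `ψ`.  Since `ψ` maps trees bijectively onto dendriform triwords it is injective,
and therefore `DT(V)` inherits the axioms of a dendriform trialgebra from `Ш(T(V))`.
-/

namespace DendRB

open Module

noncomputable section

section Linear

variable {k : Type*} [CommSemiring k]
variable {M N P Q : Type*} [AddCommMonoid M] [Module k M] [AddCommMonoid N] [Module k N]
  [AddCommMonoid P] [Module k P] [AddCommMonoid Q] [Module k Q]

theorem bilinear_eq_of_mem_span {B B' : M →ₗ[k] N →ₗ[k] P} {s : Set M} {t : Set N}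
    (h : ∀ x ∈ s, ∀ y ∈ t, B x y = B' x y) {x : M} {y : N} (hx : x ∈ Submodule.span k s)
    (hy : y ∈ Submodule.span k t) : B x y = B' x y :=
  LinearMap.eqOn_span (f := B.flip y) (g := B'.flip y)
    (fun x hx => LinearMap.eqOn_span (h x hx) hy) hx

theorem trilinear_eq_of_mem_span {T T' : M →ₗ[k] N →ₗ[k] P →ₗ[k] Q} {r : Set M} {s : Set N}
    {t : Set P} (h : ∀ x ∈ r, ∀ y ∈ s, ∀ z ∈ t, T x y z = T' x y z) {x : M} {y : N} {z : P}
    (hx : x ∈ Submodule.span k r) (hy : y ∈ Submodule.span k s) (hz : z ∈ Submodule.span k t) :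
    T x y z = T' x y z :=
  bilinear_eq_of_mem_span (B := T.compr₂ (LinearMap.applyₗ z))
    (B' := T'.compr₂ (LinearMap.applyₗ z))
    (fun x hx y hy => LinearMap.eqOn_span (h x hx y hy) hz) hx hy

theorem map_mapDomain_eq {α β ι : Type*} {L : (α →₀ k) →ₗ[k] P} {L' : (β →₀ k) →ₗ[k] P}
    {f : ι → α} {g : ι → β} (h : ∀ i, L (.single (f i) 1) = L' (.single (g i) 1)) (m : ι →₀ k) :
    L (m.mapDomain f) = L' (m.mapDomain g) := by
  suffices L ∘ₗ Finsupp.lmapDomain k k f = L' ∘ₗ Finsupp.lmapDomain k k g from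
    LinearMap.congr_fun this m
  ext i
  simpa using h i

theorem mem_span_range_single {α : Type*} (m : α →₀ k) :
    m ∈ Submodule.span k (Set.range fun a => Finsupp.single a (1 : k)) := by
  rw [← Finsupp.coe_basisSingleOne, Basis.span_eq]
  trivial

@[simp]
theorem bilin_single {k : Type*} [Field k] {α β γ : Type*} (f : α → β → (γ →₀ k)) (a : α) (b : β) :
    bilin k f (.single a 1) (.single b 1) = f a b := by
  simp [bilin]

end Linear

namespace RBOps

variable {k : Type*} [Field k] {A : Type*} [AddCommGroup A] [Module k A] {o : RBOps k A}

/-- The associative law of `o.mul` at a single triple.  Bracketed words are shown to be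
associative by recursion on the triple, whence the need for a pointwise notion. -/
def AssocAt (o : RBOps k A) (x y z : A) : Prop :=
  o.mul (o.mul x y) z = o.mul x (o.mul y z)

theorem AssocAt.of_mem_span {r s t : Set A} (h : ∀ x ∈ r, ∀ y ∈ s, ∀ z ∈ t, o.AssocAt x y z)
    {x y z : A} (hx : x ∈ Submodule.span k r) (hy : y ∈ Submodule.span k s)
    (hz : z ∈ Submodule.span k t) : o.AssocAt x y z :=
  trilinear_eq_of_mem_span (T := o.mul.compr₂ o.mul)
    (T' := (LinearMap.llcomp k A A A).compl₁₂ o.mul o.mul) h hx hy hz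

theorem AssocAt.mul_left {x y z w : A} (h₁ : o.AssocAt x y z) (h₂ : o.AssocAt x (o.mul y z) w)
    (h₃ : o.AssocAt x y (o.mul z w)) (h₄ : o.AssocAt y z w) : o.AssocAt (o.mul x y) z w := by
  unfold AssocAt at *
  rw [h₁, h₂, h₃, h₄]

theorem AssocAt.mul_middle {x y z w : A} (h₁ : o.AssocAt x y z) (h₂ : o.AssocAt (o.mul x y) z w)
    (h₃ : o.AssocAt x y (o.mul z w)) (h₄ : o.AssocAt y z w) : o.AssocAt x (o.mul y z) w := by
  unfold AssocAt at *
  rw [← h₁, h₂, h₃, h₄]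

theorem AssocAt.mul_right {x y z w : A} (h₁ : o.AssocAt x y z) (h₂ : o.AssocAt (o.mul x y) z w)
    (h₃ : o.AssocAt x (o.mul y z) w) (h₄ : o.AssocAt y z w) : o.AssocAt x y (o.mul z w) := by
  unfold AssocAt at *
  rw [← h₂, h₁, h₃, h₄]

/-- Expanding either side of the associative law at `(R u, R v, R w)` with the Rota-Baxter
identity gives `R` of a combination of the products of `u, v, w` with some of them replaced by
their images under `R`. -/
theorem AssocAt.R_R_R {wt : k}
    (hR : ∀ x y, o.mul (o.R x) (o.R y) = o.R (o.mul (o.R x) y + o.mul x (o.R y) + wt • o.mul x y))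
    {u v w : A} (h₁₂ : o.AssocAt (o.R u) (o.R v) w) (h₁₃ : o.AssocAt (o.R u) v (o.R w))
    (h₂₃ : o.AssocAt u (o.R v) (o.R w)) (h₁ : o.AssocAt (o.R u) v w)
    (h₂ : o.AssocAt u (o.R v) w) (h₃ : o.AssocAt u v (o.R w)) (h₀ : o.AssocAt u v w) :
    o.AssocAt (o.R u) (o.R v) (o.R w) := by
  unfold AssocAt at *
  rw [hR u v, hR v w, hR, hR, ← hR u v, ← hR v w]
  congr 1
  simp only [map_add, map_smul, LinearMap.add_apply, LinearMap.smul_apply]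
  linear_combination (norm := module) h₁₂ + h₁₃ + h₂₃ + wt • (h₁ + h₂ + h₃ + wt • h₀)

end RBOps

section ShaProduct

variable {k : Type*} [Field k] {B : Type*} [NonUnitalRing B] [Module k B] {X : Type*}
  (e : Basis X k B) (wt : k)

local notation:70 p:70 "⋄" q:71 => RBOps.mul (shaOps e wt) p q

/-- The basis vector of `Ш(B)` given by a Rota-Baxter word. -/
abbrev ofWord (k : Type*) [Field k] {h : Bool} (p : Word X h) : Sha k X := .single ⟨h, p⟩ 1

/-- The span of the words with head `h`: those starting with a bracket if `h = true`, those starting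
with a letter otherwise. -/
def headSpan (k : Type*) [Field k] (X : Type*) (h : Bool) : Submodule k (Sha k X) :=
  Submodule.span k (Set.range fun p : Word X h => ofWord k p)

theorem mem_span_range_ofWord (a : Sha k X) :
    a ∈ Submodule.span k (Set.range fun p : RBWord X => ofWord k p.2) :=
  mem_span_range_single a

theorem ofWord_mem_headSpan {h : Bool} (p : Word X h) : ofWord k p ∈ headSpan k X h :=
  Submodule.subset_span ⟨p, rfl⟩

theorem mapDomain_mk_mem_headSpan {h : Bool} (m : Word X h →₀ k) :
    m.mapDomain (Sigma.mk h) ∈ headSpan k X h := by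
  rw [headSpan, ← Finsupp.range_lmapDomain]
  exact ⟨m, rfl⟩

theorem mapDomain_mk_mapDomain {ι : Type*} {h : Bool} {L : Sha k X →ₗ[k] Sha k X}
    {f : ι → RBWord X} {F : ι → Word X h} (hL : ∀ i, L (.single (f i) 1) = ofWord k (F i))
    (m : ι →₀ k) : (m.mapDomain F).mapDomain (Sigma.mk h) = L (m.mapDomain f) := by
  rw [← Finsupp.mapDomain_comp]
  exact map_mapDomain_eq (L := .id) (fun i => (hL i).symm) m

theorem shaOps_mul_ofWord {h h' : Bool} (p : Word X h) (q : Word X h') :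
    ofWord k p ⋄ ofWord k q = (mulWord e wt p q).mapDomain (Sigma.mk h) :=
  bilin_single ..

@[simp]
theorem shaOps_R_ofWord {h : Bool} (u : Word X h) :
    (shaOps e wt).R (ofWord k u) = ofWord k (.bracket u) := by
  simp [shaOps]

@[simp]
theorem shaIncl_basis (x : X) : shaIncl e (e x) = ofWord k (.letter x) := by
  simp [shaIncl]

theorem shaOps_mul_mem_headSpan {h : Bool} {z : Sha k X} (hz : z ∈ headSpan k X h)
    (q : Sha k X) : z ⋄ q ∈ headSpan k X h := by
  refine LinearMap.BilinMap.apply_apply_mem_of_mem_span _ _ _ (shaOps e wt).mul ?_ z q hz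
    (mem_span_range_ofWord q)
  rintro _ ⟨p, rfl⟩ _ ⟨⟨_, q⟩, rfl⟩
  rw [shaOps_mul_ofWord]
  exact mapDomain_mk_mem_headSpan _

theorem shaIncl_mem_span_letter (a : B) :
    shaIncl e a ∈ Submodule.span k (Set.range fun x : X => ofWord k (.letter x)) := by
  rw [← Finsupp.range_lmapDomain]
  exact ⟨e.repr a, rfl⟩

theorem shaOps_R_mem_span_bracket (u : Sha k X) : (shaOps e wt).R u ∈
    Submodule.span k (Set.range fun p : RBWord X => ofWord k (.bracket p.2)) := by
  rw [← Finsupp.range_lmapDomain]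
  exact ⟨u, rfl⟩

theorem ofWord_letterCons (x : X) (z : Word X true) :
    ofWord k (.letterCons x z) = ofWord k (.letter x) ⋄ ofWord k z := by
  rw [shaOps_mul_ofWord]
  cases z <;> simp [mulWord]

theorem ofWord_bracketCons {h : Bool} (u : Word X h) (z : Word X false) :
    ofWord k (.bracketCons u z) = ofWord k (.bracket u) ⋄ ofWord k z := by
  rw [shaOps_mul_ofWord]
  cases z <;> simp [mulWord]

theorem letter_mul_R (x : X) (p : RBWord X) :
    ofWord k (.letter x) ⋄ (shaOps e wt).R (.single p 1) =
      ofWord k (appendBracket x (some p)) := by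
  rw [shaOps_R_ofWord, ← ofWord_letterCons, appendBracket]

theorem R_mul_ofWord (p : RBWord X) (z : Word X false) :
    (shaOps e wt).R (.single p 1) ⋄ ofWord k z = .single (prependBracket (some p) z) 1 := by
  rw [shaOps_R_ofWord, prependBracket, ← ofWord_bracketCons]

theorem shaOps_rota_baxter (u v : Sha k X) :
    (shaOps e wt).R u ⋄ (shaOps e wt).R v = (shaOps e wt).R
      ((shaOps e wt).R u ⋄ v + u ⋄ (shaOps e wt).R v + wt • (u ⋄ v)) := by
  let o := shaOps e wt
  refine bilinear_eq_of_mem_span (B := o.mul.compl₁₂ o.R o.R)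
    (B' := (o.mul ∘ₗ o.R + o.mul.compl₂ o.R + wt • o.mul).compr₂ o.R) ?_
    (mem_span_range_ofWord u) (mem_span_range_ofWord v)
  rintro _ ⟨⟨_, u⟩, rfl⟩ _ ⟨⟨_, v⟩, rfl⟩
  simp only [LinearMap.compl₁₂_apply, LinearMap.compr₂_apply, LinearMap.compl₂_apply,
    LinearMap.add_apply, LinearMap.smul_apply, LinearMap.comp_apply, map_add, map_smul, o,
    shaOps_R_ofWord, shaOps_mul_ofWord]
  simp only [mulWord, Finsupp.mapDomain_add, Finsupp.mapDomain_smul,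
    mapDomain_mk_mapDomain fun u => shaOps_R_ofWord e wt u]

theorem shaIncl_isAlgHom [IsScalarTower k B B] [SMulCommClass k B B] :
    (shaOps e wt).IsAlgHom (shaIncl e) := by
  intro a b
  suffices (LinearMap.mul k B).compr₂ (shaIncl e) =
      (shaOps e wt).mul.compl₁₂ (shaIncl e) (shaIncl e) from LinearMap.congr_fun₂ this a b
  refine e.ext fun x => e.ext fun y => ?_
  simp only [LinearMap.compr₂_apply, LinearMap.compl₁₂_apply, shaIncl_basis, shaOps_mul_ofWord,
    mulWord]
  exact Finsupp.mapDomain_comp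

theorem assocAt_shaIncl_of_mem_headSpan (a : B) {z : Sha k X}
    (hz : z ∈ headSpan k X true) (q : Sha k X) :
    (shaOps e wt).AssocAt (shaIncl e a) z q := by
  refine .of_mem_span ?_ (shaIncl_mem_span_letter e a) hz (mem_span_range_ofWord q)
  rintro _ ⟨x, rfl⟩ _ ⟨z, rfl⟩ _ ⟨⟨_, q⟩, rfl⟩
  dsimp only
  rw [RBOps.AssocAt, ← ofWord_letterCons, shaOps_mul_ofWord, shaOps_mul_ofWord, mulWord]
  exact mapDomain_mk_mapDomain (fun i => (ofWord_letterCons e wt x i).symm) _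

theorem assocAt_R_of_mem_headSpan (u : Sha k X) {z : Sha k X}
    (hz : z ∈ headSpan k X false) (q : Sha k X) :
    (shaOps e wt).AssocAt ((shaOps e wt).R u) z q := by
  refine .of_mem_span ?_ (shaOps_R_mem_span_bracket e wt u) hz (mem_span_range_ofWord q)
  rintro _ ⟨u, rfl⟩ _ ⟨z, rfl⟩ _ ⟨⟨_, q⟩, rfl⟩
  dsimp only
  rw [RBOps.AssocAt, ← ofWord_bracketCons, shaOps_mul_ofWord, shaOps_mul_ofWord, mulWord]
  exact mapDomain_mk_mapDomain (fun i => (ofWord_bracketCons e wt u.2 i).symm) _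

theorem assocAt_shaIncl_shaIncl_of_mem_headSpan [IsScalarTower k B B] [SMulCommClass k B B]
    (a b : B) {z : Sha k X} (hz : z ∈ headSpan k X true) :
    (shaOps e wt).AssocAt (shaIncl e a) (shaIncl e b) z := by
  refine .of_mem_span ?_ (shaIncl_mem_span_letter e a) (shaIncl_mem_span_letter e b) hz
  rintro _ ⟨x, rfl⟩ _ ⟨y, rfl⟩ _ ⟨z, rfl⟩
  dsimp only
  rw [RBOps.AssocAt, ← ofWord_letterCons, shaOps_mul_ofWord _ _ _ (.letterCons y z), mulWord,
    ← shaIncl_basis e, ← shaIncl_basis e, ← shaIncl_isAlgHom e wt]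
  exact (mapDomain_mk_mapDomain (L := (shaOps e wt).mul.flip (ofWord k z))
    (fun x => (ofWord_letterCons e wt x z).symm) _).symm

theorem assocAt_R_R_of_mem_headSpan (u v : Sha k X) {z : Sha k X} (hz : z ∈ headSpan k X false) :
    (shaOps e wt).AssocAt ((shaOps e wt).R u) ((shaOps e wt).R v) z := by
  refine .of_mem_span ?_ (shaOps_R_mem_span_bracket e wt u) (shaOps_R_mem_span_bracket e wt v) hz
  rintro _ ⟨⟨_, u⟩, rfl⟩ _ ⟨⟨_, v⟩, rfl⟩ _ ⟨z, rfl⟩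
  have mapDomain_bracketCons {h : Bool} (m : Word X h →₀ k) :
      (m.mapDomain (.bracketCons · z)).mapDomain (Sigma.mk true) =
        (shaOps e wt).R (m.mapDomain (Sigma.mk h)) ⋄ ofWord k z :=
    mapDomain_mk_mapDomain (L := (shaOps e wt).mul.flip (ofWord k z) ∘ₗ (shaOps e wt).R)
      (fun p => by simp [ofWord_bracketCons e wt]) m
  dsimp only
  rw [RBOps.AssocAt, ← ofWord_bracketCons, shaOps_mul_ofWord _ _ _ (.bracketCons v z), mulWord,
    ← shaOps_R_ofWord e wt u, ← shaOps_R_ofWord e wt v, shaOps_rota_baxter]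
  simp only [shaOps_R_ofWord, shaOps_mul_ofWord, Finsupp.mapDomain_add, Finsupp.mapDomain_smul,
    mapDomain_bracketCons, map_add, map_smul, LinearMap.add_apply, LinearMap.smul_apply]

theorem assocAt_shaIncl_shaIncl [IsScalarTower k B B] [SMulCommClass k B B] (a b : B)
    (r : Sha k X) : (shaOps e wt).AssocAt (shaIncl e a) (shaIncl e b) r := by
  have hmul (a b : B) : shaIncl e (a * b) = shaIncl e a ⋄ shaIncl e b := shaIncl_isAlgHom e wt a b
  have hιι {a b : B} {z : Sha k X} (hz : z ∈ headSpan k X true) :=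
    assocAt_shaIncl_shaIncl_of_mem_headSpan e wt a b hz
  have hιιι (c : B) : (shaOps e wt).AssocAt (shaIncl e a) (shaIncl e b) (shaIncl e c) := by
    simp only [RBOps.AssocAt, ← hmul, mul_assoc]
  refine .of_mem_span ?_ (Submodule.mem_span_singleton_self _)
    (Submodule.mem_span_singleton_self _) (mem_span_range_ofWord r)
  rintro _ rfl _ rfl _ ⟨⟨_, r⟩, rfl⟩
  dsimp only
  cases r with
  | letter y => rw [← shaIncl_basis e]; exact hιιι _
  | letterCons y z =>
    have hz := ofWord_mem_headSpan (k := k) z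
    rw [ofWord_letterCons e wt, ← shaIncl_basis e]
    refine .mul_right (hιιι _) ?_ ?_ (hιι hz)
    all_goals rw [← hmul]; exact hιι hz
  | bracket | bracketCons => exact hιι (ofWord_mem_headSpan _)

theorem assocAt_shaIncl [IsScalarTower k B B] [SMulCommClass k B B] (a : B) (q r : Sha k X) :
    (shaOps e wt).AssocAt (shaIncl e a) q r := by
  have hι {a : B} {z q : Sha k X} (hz : z ∈ headSpan k X true) :=
    assocAt_shaIncl_of_mem_headSpan e wt a hz q
  refine .of_mem_span ?_ (Submodule.mem_span_singleton_self _) (mem_span_range_ofWord q)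
    (Submodule.mem_span_singleton_self r)
  rintro _ rfl _ ⟨⟨_, q⟩, rfl⟩ _ rfl
  dsimp only
  cases q with
  | letter y => rw [← shaIncl_basis e]; exact assocAt_shaIncl_shaIncl e wt _ _ _
  | letterCons y z =>
    have hz := ofWord_mem_headSpan (k := k) z
    rw [ofWord_letterCons e wt, ← shaIncl_basis e]
    refine .mul_middle (assocAt_shaIncl_shaIncl e wt _ _ _) ?_
      (assocAt_shaIncl_shaIncl e wt _ _ _) (hι hz)
    rw [← shaIncl_isAlgHom e wt]; exact hι hz
  | bracket | bracketCons => exact hι (ofWord_mem_headSpan _)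

variable {e wt}

theorem assocAt_R_R_of_assocAt {u v : Sha k X} (hu : ∀ q r, (shaOps e wt).AssocAt u q r)
    (hv : ∀ r, (shaOps e wt).AssocAt ((shaOps e wt).R u) v r) (r : Sha k X) :
    (shaOps e wt).AssocAt ((shaOps e wt).R u) ((shaOps e wt).R v) r := by
  refine .of_mem_span ?_ (Submodule.mem_span_singleton_self _)
    (Submodule.mem_span_singleton_self _) (mem_span_range_ofWord r)
  rintro _ rfl _ rfl _ ⟨⟨_, r⟩, rfl⟩
  dsimp only
  induction r with
  | letter | letterCons => exact assocAt_R_R_of_mem_headSpan e wt u v (ofWord_mem_headSpan _)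
  | bracket w ih =>
    rw [← shaOps_R_ofWord e wt]
    exact .R_R_R (shaOps_rota_baxter e wt) ih (hv _) (hu _ _) (hv _) (hu _ _) (hu _ _) (hu _ _)
  | bracketCons w z ih =>
    have hz := ofWord_mem_headSpan (k := k) z
    rw [ofWord_bracketCons e wt, ← shaOps_R_ofWord e wt]
    refine .mul_right ?_ ?_ ?_ (assocAt_R_R_of_mem_headSpan e wt _ _ hz)
    · exact .R_R_R (shaOps_rota_baxter e wt) ih (hv _) (hu _ _) (hv _) (hu _ _) (hu _ _) (hu _ _)
    all_goals rw [shaOps_rota_baxter]; exact assocAt_R_R_of_mem_headSpan e wt _ _ hz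

theorem assocAt_R_of_assocAt {u : Sha k X} (hu : ∀ q r, (shaOps e wt).AssocAt u q r)
    (q r : Sha k X) : (shaOps e wt).AssocAt ((shaOps e wt).R u) q r := by
  refine .of_mem_span ?_ (Submodule.mem_span_singleton_self _) (mem_span_range_ofWord q)
    (Submodule.mem_span_singleton_self r)
  rintro _ rfl _ ⟨⟨_, q⟩, rfl⟩ r rfl
  dsimp only
  induction q generalizing r with
  | letter | letterCons => exact assocAt_R_of_mem_headSpan e wt u (ofWord_mem_headSpan _) _
  | bracket v ih =>
    rw [← shaOps_R_ofWord e wt]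
    exact assocAt_R_R_of_assocAt hu ih r
  | bracketCons v z =>
    have hz := ofWord_mem_headSpan (k := k) z
    rw [ofWord_bracketCons e wt, ← shaOps_R_ofWord e wt]
    refine .mul_middle (assocAt_R_R_of_mem_headSpan e wt _ _ hz) ?_
      (assocAt_R_R_of_mem_headSpan e wt _ _ (shaOps_mul_mem_headSpan e wt hz r))
      (assocAt_R_of_mem_headSpan e wt _ hz r)
    rw [shaOps_rota_baxter]
    exact assocAt_R_of_mem_headSpan e wt _ hz r

variable (e wt)

theorem shaOps_isRotaBaxter [IsScalarTower k B B] [SMulCommClass k B B] :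
    (shaOps e wt).IsRotaBaxter wt where
  rota_baxter := shaOps_rota_baxter e wt
  assoc p q r := by
    change (shaOps e wt).AssocAt p q r
    refine .of_mem_span ?_ (mem_span_range_ofWord p) (Submodule.mem_span_singleton_self q)
      (Submodule.mem_span_singleton_self r)
    rintro _ ⟨⟨_, p⟩, rfl⟩ q rfl r rfl
    dsimp only
    induction p generalizing q r with
    | letter x => rw [← shaIncl_basis e]; exact assocAt_shaIncl e wt _ q r
    | bracket u ih => rw [← shaOps_R_ofWord e wt]; exact assocAt_R_of_assocAt ih q r
    | letterCons x z ih =>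
      have hx (q r) := assocAt_shaIncl e wt (e x) q r
      rw [ofWord_letterCons e wt, ← shaIncl_basis e]
      exact .mul_left (hx _ _) (hx _ _) (hx _ _) (ih q r)
    | bracketCons u z _ ih =>
      have hu {z : Sha k X} (hz : z ∈ headSpan k X false) (q : Sha k X) :=
        assocAt_R_of_mem_headSpan e wt (ofWord k u) hz q
      have hz := ofWord_mem_headSpan (k := k) z
      rw [ofWord_bracketCons e wt, ← shaOps_R_ofWord e wt]
      exact .mul_left (hu hz _) (hu (shaOps_mul_mem_headSpan e wt hz q) _) (hu hz _) (ih q r)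

end ShaProduct

section ShaLift

variable {k : Type*} [Field k] {B : Type*} [NonUnitalRing B] [Module k B] {X : Type*}
  (e : Basis X k B) (wt : k)
  {A : Type*} [AddCommGroup A] [Module k A] (o : RBOps k A) (f : B →ₗ[k] A)

local notation:70 p:70 "⋄" q:71 => RBOps.mul (shaOps e wt) p q

theorem shaOps_hom_ext {g g' : Sha k X →ₗ[k] A} (hg : (shaOps e wt).IsHom o g)
    (hg' : (shaOps e wt).IsHom o g') (h : g ∘ₗ shaIncl e = g' ∘ₗ shaIncl e) : g = g' := by
  have hletter (x : X) : g (ofWord k (.letter x)) = g' (ofWord k (.letter x)) := by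
    simpa using LinearMap.congr_fun h (e x)
  refine Finsupp.lhom_ext' fun ⟨_, p⟩ => LinearMap.ext_ring ?_
  change g (ofWord k p) = g' (ofWord k p)
  induction p with
  | letter x => exact hletter x
  | bracket u ih => rw [← shaOps_R_ofWord e wt, hg.map_R, hg'.map_R, ih]
  | letterCons x z ih =>
    rw [ofWord_letterCons e wt, hg.map_mul, hg'.map_mul, ih, hletter]
  | bracketCons u z ihu ihz =>
    rw [ofWord_bracketCons e wt, ← shaOps_R_ofWord e wt, hg.map_mul, hg'.map_mul, hg.map_R,
      hg'.map_R, ihu, ihz]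

/-- The value on a word of the Rota-Baxter morphism extending `f`. -/
def liftWord : {h : Bool} → Word X h → A
  | _, .letter x => f (e x)
  | _, .bracket u => o.R (liftWord u)
  | _, .letterCons x z => o.mul (f (e x)) (liftWord z)
  | _, .bracketCons u z => o.mul (o.R (liftWord u)) (liftWord z)

/-- The Rota-Baxter morphism `Ш(B) → A` extending an algebra homomorphism `f : B → A`. -/
def shaLift : Sha k X →ₗ[k] A :=
  Finsupp.linearCombination k fun p : RBWord X => liftWord e o f p.2

@[simp]
theorem shaLift_ofWord {h : Bool} (p : Word X h) :
    shaLift e o f (ofWord k p) = liftWord e o f p := by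
  simp [shaLift]

theorem shaLift_comp_shaIncl : shaLift e o f ∘ₗ shaIncl e = f :=
  e.ext fun x => by simp [liftWord]

theorem shaLift_shaIncl (a : B) : shaLift e o f (shaIncl e a) = f a :=
  LinearMap.congr_fun (shaLift_comp_shaIncl e o f) a

theorem shaLift_R (a : Sha k X) :
    shaLift e o f ((shaOps e wt).R a) = o.R (shaLift e o f a) := by
  suffices shaLift e o f ∘ₗ (shaOps e wt).R = o.R ∘ₗ shaLift e o f from LinearMap.congr_fun this a
  refine Finsupp.lhom_ext' fun ⟨_, p⟩ => LinearMap.ext_ring ?_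
  change shaLift e o f ((shaOps e wt).R (ofWord k p)) = o.R (shaLift e o f (ofWord k p))
  rw [shaOps_R_ofWord, shaLift_ofWord, shaLift_ofWord, liftWord]

theorem shaLift_shaIncl_mul_of_mem_headSpan (a : B) {z : Sha k X} (hz : z ∈ headSpan k X true) :
    shaLift e o f (shaIncl e a ⋄ z) = o.mul (shaLift e o f (shaIncl e a)) (shaLift e o f z) := by
  refine bilinear_eq_of_mem_span (B := (shaOps e wt).mul.compr₂ (shaLift e o f))
    (B' := o.mul.compl₁₂ (shaLift e o f) (shaLift e o f)) ?_ (shaIncl_mem_span_letter e a) hz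
  rintro _ ⟨x, rfl⟩ _ ⟨z, rfl⟩
  simp [← ofWord_letterCons, liftWord]

theorem shaLift_R_mul_of_mem_headSpan (u : Sha k X) {z : Sha k X} (hz : z ∈ headSpan k X false) :
    shaLift e o f ((shaOps e wt).R u ⋄ z) =
      o.mul (shaLift e o f ((shaOps e wt).R u)) (shaLift e o f z) := by
  refine bilinear_eq_of_mem_span (B := (shaOps e wt).mul.compr₂ (shaLift e o f))
    (B' := o.mul.compl₁₂ (shaLift e o f) (shaLift e o f)) ?_ (shaOps_R_mem_span_bracket e wt u) hz
  rintro _ ⟨u, rfl⟩ _ ⟨z, rfl⟩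
  simp [← ofWord_bracketCons, liftWord]

variable {o f} [IsScalarTower k B B] [SMulCommClass k B B]

theorem shaLift_shaIncl_mul (ho : o.IsRotaBaxter wt) (hf : o.IsAlgHom f) (a : B) (q : Sha k X) :
    shaLift e o f (shaIncl e a ⋄ q) = o.mul (shaLift e o f (shaIncl e a)) (shaLift e o f q) := by
  have hι {a : B} {z : Sha k X} (hz : z ∈ headSpan k X true) :=
    shaLift_shaIncl_mul_of_mem_headSpan e wt o f a hz
  have hιι (a b : B) : shaLift e o f (shaIncl e a ⋄ shaIncl e b) =
      o.mul (shaLift e o f (shaIncl e a)) (shaLift e o f (shaIncl e b)) := by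
    simp only [← shaIncl_isAlgHom e wt a b, shaLift_shaIncl, hf a b]
  refine bilinear_eq_of_mem_span (B := (shaOps e wt).mul.compr₂ (shaLift e o f))
    (B' := o.mul.compl₁₂ (shaLift e o f) (shaLift e o f)) ?_ (Submodule.mem_span_singleton_self _)
    (mem_span_range_ofWord q)
  rintro _ rfl _ ⟨⟨_, q⟩, rfl⟩
  dsimp only [LinearMap.compr₂_apply, LinearMap.compl₁₂_apply]
  cases q with
  | letter y => rw [← shaIncl_basis e, hιι]
  | letterCons y z =>
    have hz := ofWord_mem_headSpan (k := k) z
    rw [ofWord_letterCons e wt, ← shaIncl_basis e, ← (shaOps_isRotaBaxter e wt).assoc, hι hz,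
      ← ho.assoc, ← hιι, ← shaIncl_isAlgHom e wt, hι hz]
  | bracket | bracketCons => exact hι (ofWord_mem_headSpan _)

theorem shaLift_R_mul (ho : o.IsRotaBaxter wt) {u : Sha k X}
    (hu : ∀ q, shaLift e o f ((shaOps e wt).mul u q) = o.mul (shaLift e o f u) (shaLift e o f q))
    (q : Sha k X) :
    shaLift e o f ((shaOps e wt).R u ⋄ q) =
      o.mul (shaLift e o f ((shaOps e wt).R u)) (shaLift e o f q) := by
  have hR {u z : Sha k X} (hz : z ∈ headSpan k X false) :=
    shaLift_R_mul_of_mem_headSpan e wt o f u hz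
  have hRR {v : Sha k X} (ih : shaLift e o f ((shaOps e wt).R u ⋄ v) =
      o.mul (shaLift e o f ((shaOps e wt).R u)) (shaLift e o f v)) :
      shaLift e o f ((shaOps e wt).R u ⋄ (shaOps e wt).R v) =
        o.mul (shaLift e o f ((shaOps e wt).R u)) (shaLift e o f ((shaOps e wt).R v)) := by
    simp only [shaOps_rota_baxter, shaLift_R, map_add, map_smul, ih, hu, ho.rota_baxter]
  refine bilinear_eq_of_mem_span (B := (shaOps e wt).mul.compr₂ (shaLift e o f))
    (B' := o.mul.compl₁₂ (shaLift e o f) (shaLift e o f)) ?_ (Submodule.mem_span_singleton_self _)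
    (mem_span_range_ofWord q)
  rintro _ rfl _ ⟨⟨_, q⟩, rfl⟩
  dsimp only [LinearMap.compr₂_apply, LinearMap.compl₁₂_apply]
  induction q with
  | letter | letterCons => exact hR (ofWord_mem_headSpan _)
  | bracket v ih => rw [← shaOps_R_ofWord e wt, hRR ih]
  | bracketCons v z ih =>
    have hz := ofWord_mem_headSpan (k := k) z
    rw [ofWord_bracketCons e wt, ← shaOps_R_ofWord e wt, ← (shaOps_isRotaBaxter e wt).assoc,
      hR hz, ← ho.assoc, ← hRR ih, shaOps_rota_baxter, hR hz]

theorem shaLift_isHom (ho : o.IsRotaBaxter wt) (hf : o.IsAlgHom f) :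
    (shaOps e wt).IsHom o (shaLift e o f) where
  map_R := shaLift_R e wt o f
  map_mul p q := by
    have assoc := (shaOps_isRotaBaxter e wt).assoc
    refine bilinear_eq_of_mem_span (B := (shaOps e wt).mul.compr₂ (shaLift e o f))
      (B' := o.mul.compl₁₂ (shaLift e o f) (shaLift e o f)) ?_ (mem_span_range_ofWord p)
      (Submodule.mem_span_singleton_self q)
    rintro _ ⟨⟨_, p⟩, rfl⟩ q rfl
    dsimp only [LinearMap.compr₂_apply, LinearMap.compl₁₂_apply]
    induction p generalizing q with
    | letter x => rw [← shaIncl_basis e, shaLift_shaIncl_mul e wt ho hf]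
    | bracket u ih => rw [← shaOps_R_ofWord e wt, shaLift_R_mul e wt ho ih]
    | letterCons x z ih =>
      have hι := shaLift_shaIncl_mul e wt ho hf (e x)
      rw [ofWord_letterCons e wt, ← shaIncl_basis e, assoc, hι, hι, ih, ho.assoc]
    | bracketCons u z _ ih =>
      have hR {z : Sha k X} (hz : z ∈ headSpan k X false) :=
        shaLift_R_mul_of_mem_headSpan e wt o f (ofWord k u) hz
      have hz := ofWord_mem_headSpan (k := k) z
      rw [ofWord_bracketCons e wt, ← shaOps_R_ofWord e wt, assoc,
        hR (shaOps_mul_mem_headSpan e wt hz q), hR hz, ih, ho.assoc]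

theorem shaOps_isFree : RBOps.IsFree.{w} (shaOps e wt) wt (shaIncl e) := by
  refine ⟨shaOps_isRotaBaxter e wt, shaIncl_isAlgHom e wt, fun A _ _ o ho f hf => ?_⟩
  have hom := shaLift_isHom e wt ho hf
  have hcomp := shaLift_comp_shaIncl e o f
  exact ⟨shaLift e o f, ⟨hom, hcomp⟩,
    fun g ⟨hg, hgf⟩ => shaOps_hom_ext e wt o hg hom (hgf.trans hcomp.symm)⟩

end ShaLift

section ToTri

variable {k A : Type*} [Field k] [AddCommGroup A] [Module k A] (o : RBOps k A) (wt : k) (x y : A)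

theorem RBOps.toTri_prec_apply : (o.toTri wt).prec x y = o.mul x (o.R y) := rfl

theorem RBOps.toTri_succ_apply : (o.toTri wt).succ x y = o.mul (o.R x) y := rfl

theorem RBOps.toTri_dot_apply : (o.toTri wt).dot x y = wt • o.mul x y := rfl

variable {o wt}

theorem RBOps.IsRotaBaxter.toTri_isDendriform (ho : o.IsRotaBaxter wt) :
    (o.toTri wt).IsDendriform := by
  constructor <;> intro x y z <;>
    simp only [TriOps.star, RBOps.toTri_prec_apply, RBOps.toTri_succ_apply, RBOps.toTri_dot_apply,
      LinearMap.add_apply, LinearMap.smul_apply, map_smul, ho.assoc, ho.rota_baxter]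
  · rw [add_comm (o.mul (o.R y) z)]
  · rw [← ho.assoc, ho.rota_baxter, add_comm (o.mul x (o.R y))]

end ToTri

section DTLift

variable {k : Type*} [Field k] {Ω : Type*}

@[simp]
theorem starTree_leaf_left (U : Tree Ω) : starTree k .leaf U = .single U 1 := by
  cases U <;> simp only [starTree]

@[simp]
theorem starTree_leaf_right (T : Tree Ω) : starTree k T .leaf = .single T 1 := by
  cases T <;> simp only [starTree]

@[simp]
theorem Node.setFirst_first (t : Node Ω) : t.setFirst t.first = t := by
  cases t <;> rfl

@[simp]
theorem Node.setLast_last : (t : Node Ω) → t.setLast t.last = t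
  | .two _ _ _ => rfl
  | .cons _ _ t => congrArg _ t.setLast_last

theorem dtOps_prec_single (t s : Node Ω) : (dtOps k Ω).prec (.single t 1) (.single s 1) =
    (starTree k t.last (.node s)).mapDomain fun S => t.setLast S :=
  bilin_single ..

theorem dtOps_succ_single (t s : Node Ω) : (dtOps k Ω).succ (.single t 1) (.single s 1) =
    (starTree k (.node t) s.first).mapDomain fun S => s.setFirst S :=
  bilin_single ..

theorem dtOps_dot_single (t s : Node Ω) : (dtOps k Ω).dot (.single t 1) (.single s 1) =
    (starTree k t.last s.first).mapDomain fun S => Node.fuse S s t :=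
  bilin_single ..

theorem dtOps_prec_two_leaf (l : Tree Ω) (x : Ω) (t : Node Ω) :
    (dtOps k Ω).prec (.single (.two l x .leaf) 1) (.single t 1) =
      .single (.two l x (.node t)) 1 := by
  simp [dtOps_prec_single, Node.last, Node.setLast]

theorem dtOps_succ_two_leaf (t : Node Ω) (x : Ω) (r : Tree Ω) :
    (dtOps k Ω).succ (.single t 1) (.single (.two .leaf x r) 1) =
      .single (.two (.node t) x r) 1 := by
  simp [dtOps_succ_single, Node.first, Node.setFirst]

theorem dtOps_dot_two_leaf (l : Tree Ω) (x : Ω) (t : Node Ω) :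
    (dtOps k Ω).dot (.single (.two l x .leaf) 1) (.single t 1) = .single (.cons l x t) 1 := by
  simp [dtOps_dot_single, Node.last, Node.fuse]

theorem starTree_node_node (t s : Node Ω) : starTree k (.node t) (.node s) =
    ((dtOps k Ω).star (.single t 1) (.single s 1)).mapDomain Tree.node := by
  rw [starTree]
  simp only [TriOps.star, LinearMap.add_apply, dtOps_prec_single, dtOps_succ_single,
    dtOps_dot_single, Finsupp.mapDomain_add, ← Finsupp.mapDomain_comp]
  rfl

variable {V : Type*} [AddCommGroup V] [Module k V] (b : Basis Ω k V)

@[simp]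
theorem dtIncl_basis (x : Ω) : dtIncl b (b x) = .single (.two .leaf x .leaf) 1 := by
  simp [dtIncl]

variable {E : Type*} [AddCommGroup E] [Module k E]

section HomExt

variable {o : TriOps k E} {g g' : DT k Ω →ₗ[k] E}

mutual
theorem dtOps_hom_eq_on_node (hg : (dtOps k Ω).IsHom o g) (hg' : (dtOps k Ω).IsHom o g')
    (h : ∀ x, g (.single (.two .leaf x .leaf) 1) = g' (.single (.two .leaf x .leaf) 1)) :
    (t : Node Ω) → g (.single t 1) = g' (.single t 1)
  | .two l x .leaf => dtOps_hom_eq_on_two_leaf hg hg' h l x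
  | .two l x (.node t) => by
    rw [← dtOps_prec_two_leaf, hg.map_prec, hg'.map_prec, dtOps_hom_eq_on_two_leaf hg hg' h l,
      dtOps_hom_eq_on_node hg hg' h t]
  | .cons l x t => by
    rw [← dtOps_dot_two_leaf, hg.map_dot, hg'.map_dot, dtOps_hom_eq_on_two_leaf hg hg' h l,
      dtOps_hom_eq_on_node hg hg' h t]
theorem dtOps_hom_eq_on_two_leaf (hg : (dtOps k Ω).IsHom o g) (hg' : (dtOps k Ω).IsHom o g')
    (h : ∀ x, g (.single (.two .leaf x .leaf) 1) = g' (.single (.two .leaf x .leaf) 1)) :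
    (l : Tree Ω) → ∀ x, g (.single (.two l x .leaf) 1) = g' (.single (.two l x .leaf) 1)
  | .leaf, x => h x
  | .node t, x => by
    rw [← dtOps_succ_two_leaf, hg.map_succ, hg'.map_succ, dtOps_hom_eq_on_node hg hg' h t, h]
end

theorem dtOps_hom_ext (hg : (dtOps k Ω).IsHom o g) (hg' : (dtOps k Ω).IsHom o g')
    (h : g ∘ₗ dtIncl b = g' ∘ₗ dtIncl b) : g = g' := by
  have hV (x : Ω) : g (.single (.two .leaf x .leaf) 1) = g' (.single (.two .leaf x .leaf) 1) := by
    simpa using LinearMap.congr_fun h (b x)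
  ext t
  simpa using dtOps_hom_eq_on_node hg hg' hV t

end HomExt

section Lift

variable (o : TriOps k E) (f : Ω → E)

mutual
/-- The value in the trialgebra `E` of a tree other than `|`, when `| ∨_x |` has the value `f x`:
`T₀ ∨_{x₁} ⋯ ∨_{xₙ} Tₙ` is `(T₀ ≻ x₁) · (T₁ ≻ x₂) · ⋯ · (Tₙ₋₁ ≻ xₙ) ≺ Tₙ`. -/
def liftNode : Node Ω → E
  | .two l x r => treePrec r (treeSucc l (f x))
  | .cons l x t => o.dot (treeSucc l (f x)) (liftNode t)
/-- The operator `T ≻ -` on the trialgebra `E` for the value of the tree `T`, where `|` acts as a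
unit. -/
def treeSucc : Tree Ω → E →ₗ[k] E
  | .leaf => LinearMap.id
  | .node t => o.succ (liftNode t)
/-- The operator `- ≺ T` on the trialgebra `E` for the value of the tree `T`, where `|` acts as a
unit. -/
def treePrec : Tree Ω → E →ₗ[k] E
  | .leaf => LinearMap.id
  | .node t => o.prec.flip (liftNode t)
end

/-- The linear map `DT(V) → E` extending `liftNode`: the morphism induced by `f : Ω → E` if `E`
is a dendriform trialgebra. -/
def dtLift : DT k Ω →ₗ[k] E := Finsupp.linearCombination k (liftNode o f)

@[simp]
theorem dtLift_single (t : Node Ω) : dtLift o f (.single t 1) = liftNode o f t := by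
  simp [dtLift]

theorem dtLift_comp_dtIncl (f : V →ₗ[k] E) : dtLift o (fun x => f (b x)) ∘ₗ dtIncl b = f :=
  b.ext fun x => by simp [liftNode, treePrec, treeSucc]

theorem linearCombination_treeSucc_node (a : DT k Ω) :
    Finsupp.linearCombination k (treeSucc o f) (a.mapDomain .node) = o.succ (dtLift o f a) := by
  rw [Finsupp.linearCombination_mapDomain, dtLift, Finsupp.apply_linearCombination]
  rfl

theorem linearCombination_treePrec_node (a : DT k Ω) :
    Finsupp.linearCombination k (treePrec o f) (a.mapDomain .node) =
      o.prec.flip (dtLift o f a) := by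
  rw [Finsupp.linearCombination_mapDomain, dtLift, Finsupp.apply_linearCombination]
  rfl

variable {o}

theorem treePrec_treeSucc (ho : o.IsDendriform) (S T : Tree Ω) (a : E) :
    treePrec o f S (treeSucc o f T a) = treeSucc o f T (treePrec o f S a) := by
  cases S <;> cases T <;> simp [treePrec, treeSucc, ho.succ_prec]

theorem dot_treePrec (ho : o.IsDendriform) (S : Tree Ω) (a c : E) :
    o.dot (treePrec o f S a) c = o.dot a (treeSucc o f S c) := by
  cases S <;> simp [treePrec, treeSucc, ho.prec_dot]

theorem treeSucc_dot (ho : o.IsDendriform) (T : Tree Ω) (a c : E) :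
    o.dot (treeSucc o f T a) c = treeSucc o f T (o.dot a c) := by
  cases T <;> simp [treeSucc, ho.succ_dot]

theorem treePrec_dot (ho : o.IsDendriform) (T : Tree Ω) (a c : E) :
    treePrec o f T (o.dot a c) = o.dot a (treePrec o f T c) := by
  cases T <;> simp [treePrec, ho.dot_prec]

theorem liftNode_setFirst (ho : o.IsDendriform) (S : Tree Ω) (t : Node Ω) :
    liftNode o f (t.setFirst S) = treeSucc o f S (liftNode o f (t.setFirst .leaf)) := by
  cases t <;>
    simp [Node.setFirst, liftNode, treePrec_treeSucc f ho, treeSucc_dot f ho, treeSucc.eq_1]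

theorem liftNode_setLast (ho : o.IsDendriform) (S : Tree Ω) : (t : Node Ω) →
    liftNode o f (t.setLast S) = treePrec o f S (liftNode o f (t.setLast .leaf))
  | .two _ _ _ => by simp [Node.setLast, liftNode, treePrec]
  | .cons _ _ t => by
    simp only [Node.setLast, liftNode, liftNode_setLast ho S t, treePrec_dot f ho]

theorem liftNode_fuse (ho : o.IsDendriform) (S : Tree Ω) (s : Node Ω) : (t : Node Ω) →
    liftNode o f (Node.fuse S s t) =
      o.dot (liftNode o f (t.setLast S)) (liftNode o f (s.setFirst .leaf))
  | .two _ _ _ => by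
    simp only [Node.fuse, Node.setLast, liftNode, liftNode_setFirst f ho S s, dot_treePrec f ho]
  | .cons _ _ t => by
    simp only [Node.fuse, Node.setLast, liftNode, liftNode_fuse ho S s t, ho.dot_dot]

theorem dtLift_mapDomain_setFirst (ho : o.IsDendriform) (m : Tree Ω →₀ k) (t : Node Ω) :
    dtLift o f (m.mapDomain fun S => t.setFirst S) =
      Finsupp.linearCombination k (treeSucc o f) m (liftNode o f (t.setFirst .leaf)) := by
  simpa using map_mapDomain_eq (L := dtLift o f) (f := fun S => t.setFirst S) (g := id)
    (L' := LinearMap.applyₗ (liftNode o f (t.setFirst .leaf)) ∘ₗ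
      Finsupp.linearCombination k (treeSucc o f))
    (fun S => by simpa using liftNode_setFirst f ho S t) m

theorem dtLift_mapDomain_setLast (ho : o.IsDendriform) (m : Tree Ω →₀ k) (t : Node Ω) :
    dtLift o f (m.mapDomain fun S => t.setLast S) =
      Finsupp.linearCombination k (treePrec o f) m (liftNode o f (t.setLast .leaf)) := by
  simpa using map_mapDomain_eq (L := dtLift o f) (f := fun S => t.setLast S) (g := id)
    (L' := LinearMap.applyₗ (liftNode o f (t.setLast .leaf)) ∘ₗ
      Finsupp.linearCombination k (treePrec o f))
    (fun S => by simpa using liftNode_setLast f ho S t) m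

theorem dtLift_mapDomain_fuse (ho : o.IsDendriform) (m : Tree Ω →₀ k) (t s : Node Ω) :
    dtLift o f (m.mapDomain fun S => Node.fuse S s t) =
      o.dot (dtLift o f (m.mapDomain fun S => t.setLast S))
        (liftNode o f (s.setFirst .leaf)) :=
  map_mapDomain_eq (L' := o.dot.flip (liftNode o f (s.setFirst .leaf)) ∘ₗ dtLift o f)
    (fun S => by simpa using liftNode_fuse f ho S s t) m

theorem dtLift_prec_single (ho : o.IsDendriform) {t s : Node Ω}
    (h : Finsupp.linearCombination k (treePrec o f) (starTree k t.last (.node s)) =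
      treePrec o f (.node s) ∘ₗ treePrec o f t.last) :
    dtLift o f ((dtOps k Ω).prec (.single t 1) (.single s 1)) =
      o.prec (liftNode o f t) (liftNode o f s) := by
  rw [dtOps_prec_single, dtLift_mapDomain_setLast f ho, h, LinearMap.comp_apply,
    ← liftNode_setLast f ho, Node.setLast_last, treePrec, LinearMap.flip_apply]

theorem dtLift_succ_single (ho : o.IsDendriform) {t s : Node Ω}
    (h : Finsupp.linearCombination k (treeSucc o f) (starTree k (.node t) s.first) =
      treeSucc o f (.node t) ∘ₗ treeSucc o f s.first) :
    dtLift o f ((dtOps k Ω).succ (.single t 1) (.single s 1)) =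
      o.succ (liftNode o f t) (liftNode o f s) := by
  rw [dtOps_succ_single, dtLift_mapDomain_setFirst f ho, h, LinearMap.comp_apply,
    ← liftNode_setFirst f ho, Node.setFirst_first, treeSucc]

theorem dtLift_dot_single (ho : o.IsDendriform) {t s : Node Ω}
    (h : Finsupp.linearCombination k (treePrec o f) (starTree k t.last s.first) =
      treePrec o f s.first ∘ₗ treePrec o f t.last) :
    dtLift o f ((dtOps k Ω).dot (.single t 1) (.single s 1)) =
      o.dot (liftNode o f t) (liftNode o f s) := by
  rw [dtOps_dot_single, dtLift_mapDomain_fuse f ho, dtLift_mapDomain_setLast f ho, h,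
    LinearMap.comp_apply, ← liftNode_setLast f ho, Node.setLast_last, dot_treePrec f ho,
    ← liftNode_setFirst f ho, Node.setFirst_first]

theorem linearCombination_starTree (ho : o.IsDendriform) (T U : Tree Ω) :
    Finsupp.linearCombination k (treeSucc o f) (starTree k T U) =
        treeSucc o f T ∘ₗ treeSucc o f U ∧
      Finsupp.linearCombination k (treePrec o f) (starTree k T U) =
        treePrec o f U ∘ₗ treePrec o f T := by
  induction T, U using starTree.induct with
  | case1 | case2 => simp [treeSucc, treePrec]
  | case3 t s ih_prec ih_succ ih_dot =>
    have map_star : dtLift o f ((dtOps k Ω).star (.single t 1) (.single s 1)) =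
        o.star (liftNode o f t) (liftNode o f s) := by
      simp only [TriOps.star, LinearMap.add_apply, map_add, dtLift_prec_single f ho ih_prec.2,
        dtLift_succ_single f ho ih_succ.1, dtLift_dot_single f ho ih_dot.2]
    rw [starTree_node_node, linearCombination_treeSucc_node, linearCombination_treePrec_node,
      map_star]
    exact ⟨LinearMap.ext fun a => ho.star_succ _ _ a,
      LinearMap.ext fun a => (ho.prec_prec a _ _).symm⟩

theorem dtLift_isHom (ho : o.IsDendriform) : (dtOps k Ω).IsHom o (dtLift o f) := by
  have h := linearCombination_starTree (k := k) f ho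
  have of_single {m : DT k Ω →ₗ[k] DT k Ω →ₗ[k] DT k Ω} {m' : E →ₗ[k] E →ₗ[k] E}
      (hm : ∀ t s, dtLift o f (m (.single t 1) (.single s 1)) =
        m' (liftNode o f t) (liftNode o f s)) (a c : DT k Ω) :
      dtLift o f (m a c) = m' (dtLift o f a) (dtLift o f c) := by
    refine bilinear_eq_of_mem_span (B := m.compr₂ (dtLift o f))
      (B' := m'.compl₁₂ (dtLift o f) (dtLift o f)) ?_ (mem_span_range_single a)
      (mem_span_range_single c)
    rintro _ ⟨t, rfl⟩ _ ⟨s, rfl⟩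
    simpa using hm t s
  exact ⟨of_single fun _ _ => dtLift_prec_single f ho (h _ _).2,
    of_single fun _ _ => dtLift_succ_single f ho (h _ _).1,
    of_single fun _ _ => dtLift_dot_single f ho (h _ _).2⟩

end Lift

end DTLift

theorem TriOps.IsDendriform.of_injective {k D E : Type*} [Field k] [AddCommGroup D] [Module k D]
    [AddCommGroup E] [Module k E] {o : TriOps k D} {o' : TriOps k E} (ho' : o'.IsDendriform)
    {g : D →ₗ[k] E} (hg : o.IsHom o' g) (inj : Function.Injective g) : o.IsDendriform := by
  have map_star (x y : D) : g (o.star x y) = o'.star (g x) (g y) := by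
    simp only [TriOps.star, LinearMap.add_apply, map_add, hg.map_prec, hg.map_succ, hg.map_dot]
  constructor <;> intro x y z <;> apply inj <;>
    simp only [hg.map_prec, hg.map_succ, hg.map_dot, map_star]
  exacts [ho'.prec_prec _ _ _, ho'.succ_prec _ _ _, ho'.star_succ _ _ _, ho'.succ_dot _ _ _,
    ho'.prec_dot _ _ _, ho'.dot_prec _ _ _, ho'.dot_dot _ _ _]

section Triwords

open Word

variable {Ω : Type*}

theorem freeSemigroup_of_inj {x x' : Ω} : FreeSemigroup.of x = FreeSemigroup.of x' ↔ x = x' :=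
  ⟨fun h => congrArg FreeSemigroup.head h, congrArg _⟩

theorem freeSemigroup_of_mul_inj {x x' : Ω} {s s' : FreeSemigroup Ω} :
    FreeSemigroup.of x * s = FreeSemigroup.of x' * s' ↔ x = x' ∧ s = s' := by
  simp [FreeSemigroup.ext_iff, FreeSemigroup.of]

theorem freeSemigroup_of_mul_ne_of {x x' : Ω} {s : FreeSemigroup Ω} :
    FreeSemigroup.of x * s ≠ FreeSemigroup.of x' := by
  simp [FreeSemigroup.ext_iff, FreeSemigroup.of]

theorem prepend_inj {x x' : Ω} : {p p' : RBWord (FreeSemigroup Ω)} →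
    prepend x p.2 = prepend x' p'.2 → x = x' ∧ p = p' := by
  rintro ⟨h, p⟩ ⟨h', p'⟩ e
  cases p <;> cases p' <;>
    simp_all [prepend, freeSemigroup_of_mul_inj, freeSemigroup_of_mul_ne_of,
      freeSemigroup_of_mul_ne_of.symm, freeSemigroup_of_inj]

theorem appendBracket_inj {X : Type*} {x x' : X} : {r r' : Option (RBWord X)} →
    appendBracket x r = appendBracket x' r' → x = x' ∧ r = r' := by
  rintro (_ | ⟨_, _⟩) (_ | ⟨_, _⟩) e <;> simp_all [appendBracket]

theorem prependBracket_inj {X : Type*} {z z' : Word X false} : {l l' : Option (RBWord X)} →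
    prependBracket l z = prependBracket l' z' → l = l' ∧ z = z' := by
  rintro (_ | ⟨_, _⟩) (_ | ⟨_, _⟩) e <;> simp_all [prependBracket]

theorem appendBracket_ne_prepend {x x' : Ω} {r : Option (RBWord (FreeSemigroup Ω))} {h : Bool}
    {z : Word (FreeSemigroup Ω) h} (hz : ¬ z.IsBracket) :
    appendBracket (FreeSemigroup.of x) r ≠ prepend x' z := by
  cases r <;> cases z <;>
    simp_all [appendBracket, prepend, freeSemigroup_of_mul_ne_of.symm, IsBracket]

theorem not_isBracket_of_head_eq_false {X : Type*} : (z : Word X false) → ¬ z.IsBracket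
  | letter _ => id
  | letterCons _ _ => id

theorem noDouble_prepend (x : Ω) {h : Bool} {z : Word (FreeSemigroup Ω) h} (hz : z.NoDouble) :
    (prepend x z).NoDouble := by
  cases z <;> exact hz

theorem noDouble_appendBracket {X : Type*} (x : X) : {r : Option (RBWord X)} →
    (∀ p ∈ r, p.2.IsTriword) → (appendBracket x r).NoDouble
  | none, _ => trivial
  | some p, h => h p rfl

theorem isTriword_prependBracket {X : Type*} {z : Word X false} (hz : z.NoDouble) :
    {l : Option (RBWord X)} → (∀ p ∈ l, p.2.IsTriword) → (prependBracket l z).2.IsTriword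
  | none, _ => ⟨not_isBracket_of_head_eq_false z, hz⟩
  | some p, h => ⟨id, (h p rfl).1, (h p rfl).2, hz⟩

mutual
theorem isTriword_psiNode : (t : Node Ω) → (psiNode t).2.IsTriword
  | .two l x r => by
    rw [psiNode]
    exact isTriword_prependBracket (noDouble_appendBracket _ (isTriword_psiTree r))
      (isTriword_psiTree l)
  | .cons l x t => by
    rw [psiNode]
    exact isTriword_prependBracket (noDouble_prepend x (isTriword_psiNode t).2)
      (isTriword_psiTree l)
theorem isTriword_psiTree : (T : Tree Ω) → ∀ p ∈ psiTree T, p.2.IsTriword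
  | .leaf => by simp [psiTree]
  | .node t => by
    rw [psiTree]
    rintro p ⟨⟩
    exact isTriword_psiNode t
end

mutual
theorem psiNode_inj : (t t' : Node Ω) → psiNode t = psiNode t' → t = t'
  | .two l x r, .two l' x' r', h => by
    rw [psiNode, psiNode] at h
    obtain ⟨hl, h⟩ := prependBracket_inj h
    obtain ⟨hx, hr⟩ := appendBracket_inj h
    rw [psiTree_inj l l' hl, psiTree_inj r r' hr, freeSemigroup_of_inj.1 hx]
  | .two l x r, .cons l' x' t', h => by
    rw [psiNode, psiNode] at h
    exact absurd (prependBracket_inj h).2 (appendBracket_ne_prepend (isTriword_psiNode t').1)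
  | .cons l x t, .two l' x' r', h => by
    rw [psiNode, psiNode] at h
    exact absurd (prependBracket_inj h).2.symm (appendBracket_ne_prepend (isTriword_psiNode t).1)
  | .cons l x t, .cons l' x' t', h => by
    rw [psiNode, psiNode] at h
    obtain ⟨hl, h⟩ := prependBracket_inj h
    obtain ⟨rfl, ht⟩ := prepend_inj h
    rw [psiTree_inj l l' hl, psiNode_inj t t' ht]
theorem psiTree_inj : (T T' : Tree Ω) → psiTree T = psiTree T' → T = T'
  | .leaf, .leaf, _ => rfl
  | .leaf, .node _, h => by simp [psiTree] at h
  | .node _, .leaf, h => by simp [psiTree] at h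
  | .node t, .node t', h => by
    simp only [psiTree, Option.some.injEq] at h
    rw [psiNode_inj t t' h]
end

theorem psiNode_injective : Function.Injective (psiNode (Ω := Ω)) := fun t t' => psiNode_inj t t'

theorem psi_injective (k : Type*) [Field k] : Function.Injective (psi k Ω) :=
  Finsupp.mapDomain_injective psiNode_injective

theorem psiNode_cons_leaf (x : Ω) {t : Node Ω} {h : Bool} {p : Word (FreeSemigroup Ω) h}
    (ht : psiNode t = ⟨h, p⟩) : psiNode (.cons .leaf x t) = ⟨false, prepend x p⟩ := by
  rw [psiNode, psiTree, ht, prependBracket]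

theorem letter_mem_range_psiNode (s : FreeSemigroup Ω) :
    ⟨false, letter s⟩ ∈ Set.range (psiNode (Ω := Ω)) := by
  induction s using FreeSemigroup.recOnMul with
  | ih1 x =>
    exact ⟨.two .leaf x .leaf, by rw [psiNode, psiTree, prependBracket, appendBracket]⟩
  | ih2 x y _ ih =>
    obtain ⟨t, ht⟩ := ih
    exact ⟨.cons .leaf x t, psiNode_cons_leaf x ht⟩

theorem letterCons_mem_range_psiNode {z : Word (FreeSemigroup Ω) true}
    (hz : ∀ x, ⟨false, prepend x z⟩ ∈ Set.range (psiNode (Ω := Ω))) (s : FreeSemigroup Ω) :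
    ⟨false, letterCons s z⟩ ∈ Set.range (psiNode (Ω := Ω)) := by
  induction s using FreeSemigroup.recOnMul with
  | ih1 x => cases z <;> exact hz x
  | ih2 x y _ ih =>
    obtain ⟨t, ht⟩ := ih
    exact ⟨.cons .leaf x t, psiNode_cons_leaf x ht⟩

theorem bracketCons_mem_range_psiNode {u : RBWord (FreeSemigroup Ω)}
    {z : Word (FreeSemigroup Ω) false} (hu : u ∈ Set.range (psiNode (Ω := Ω)))
    (hz : ⟨false, z⟩ ∈ Set.range (psiNode (Ω := Ω))) :
    ⟨true, bracketCons u.2 z⟩ ∈ Set.range (psiNode (Ω := Ω)) := by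
  obtain ⟨t, rfl⟩ := hu
  obtain ⟨s, hs⟩ := hz
  have prependBracket_eq {l : Tree Ω} {z' : Word (FreeSemigroup Ω) false}
      (h : prependBracket (psiTree l) z' = ⟨false, z⟩) : z' = z :=
    (prependBracket_inj (l' := none) h).2
  cases s with
  | two l x r =>
    rw [psiNode] at hs
    exact ⟨.two (.node t) x r, by
      rw [psiNode, psiTree, prependBracket_eq hs, prependBracket]⟩
  | cons l x s =>
    rw [psiNode] at hs
    exact ⟨.cons (.node t) x s, by
      rw [psiNode, psiTree, prependBracket_eq hs, prependBracket]⟩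

/-- The second conclusion is what makes the induction go through: `⌊u⌋` is not the image of a
tree, but `x ⌊u⌋` is. -/
theorem mem_range_psiNode {h : Bool} (p : Word (FreeSemigroup Ω) h) (hp : p.NoDouble) :
    (¬ p.IsBracket → ⟨h, p⟩ ∈ Set.range (psiNode (Ω := Ω))) ∧
      ∀ x, ⟨false, prepend x p⟩ ∈ Set.range (psiNode (Ω := Ω)) := by
  induction p with
  | letter s =>
    exact ⟨fun _ => letter_mem_range_psiNode s, fun x => letter_mem_range_psiNode _⟩
  | bracket u ih =>
    obtain ⟨t, ht⟩ := (ih hp.2).1 hp.1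
    refine ⟨fun hu => (hu trivial).elim, fun x => ⟨.two .leaf x (.node t), ?_⟩⟩
    rw [psiNode, psiTree, psiTree, ht, prependBracket, appendBracket, prepend]
  | letterCons s z ih =>
    exact ⟨fun _ => letterCons_mem_range_psiNode (ih hp).2 s,
      fun x => letterCons_mem_range_psiNode (ih hp).2 _⟩
  | bracketCons u z ihu ihz =>
    obtain ⟨t, ht⟩ := bracketCons_mem_range_psiNode ((ihu hp.2.1).1 hp.1)
      ((ihz hp.2.2).1 (not_isBracket_of_head_eq_false z))
    exact ⟨fun _ => ⟨t, ht⟩, fun x => ⟨.cons .leaf x t, psiNode_cons_leaf x ht⟩⟩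

theorem range_psiNode : Set.range (psiNode (Ω := Ω)) = {p | p.2.IsTriword} := by
  ext p
  refine ⟨?_, fun hp => (mem_range_psiNode p.2 hp.2).1 hp.1⟩
  rintro ⟨t, rfl⟩
  exact isTriword_psiNode t

theorem range_psi (k : Type*) [Field k] :
    LinearMap.range (psi k Ω) = triwordSpan k (FreeSemigroup Ω) := by
  have image_eq : {a : Sha k (FreeSemigroup Ω) | ∃ p, p.2.IsTriword ∧ a = Finsupp.single p 1} =
      (fun p => Finsupp.single p 1) '' Set.range psiNode := by
    ext a
    simp only [range_psiNode, Set.mem_image, Set.mem_ofPred_eq, eq_comm]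
  rw [psi, Finsupp.range_lmapDomain, triwordSpan, image_eq, ← Set.range_comp, Function.comp_def]

end Triwords

section PsiHom

variable {k : Type*} [Field k] {V : Type*} [AddCommGroup V] [Module k V] {Ω : Type*}
  (b : Basis Ω k V)

theorem tposBasis_apply (s : FreeSemigroup Ω) : tposBasis b s = pureTensor b s :=
  Basis.mk_apply ..

theorem tposBasis_mul (s t : FreeSemigroup Ω) :
    tposBasis b s * tposBasis b t = tposBasis b (s * t) := by
  simp only [tposBasis_apply, map_mul]

theorem shaIncl_tposIncl (x : Ω) : shaIncl (tposBasis b) (tposIncl k V (b x)) =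
    ofWord k (.letter (FreeSemigroup.of x)) := by
  rw [← shaIncl_basis (tposBasis b), tposBasis_apply, pureTensor, FreeSemigroup.lift_of]

theorem letter_of_mul_ofWord (wt : k) (x : Ω) {h : Bool} (p : Word (FreeSemigroup Ω) h) :
    (shaOps (tposBasis b) wt).mul (ofWord k (.letter (FreeSemigroup.of x))) (ofWord k p) =
      ofWord k (prepend x p) := by
  cases p <;> simp [shaOps_mul_ofWord, mulWord, prepend, tposBasis_mul]

mutual
theorem liftNode_eq_psiNode : (t : Node Ω) →
    liftNode ((shaOps (tposBasis b) 1).toTri 1)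
      (fun x => (shaIncl (tposBasis b) ∘ₗ tposIncl k V) (b x)) t = .single (psiNode t) 1
  | .two l x .leaf => by
    rw [liftNode, psiNode, treePrec, psiTree, appendBracket, LinearMap.comp_apply,
      shaIncl_tposIncl]
    exact treeSucc_eq_prependBracket l _
  | .two l x (.node r) => by
    have dendriform := (shaOps_isRotaBaxter (tposBasis b) (1 : k)).toTri_isDendriform
    rw [liftNode, psiNode, treePrec_treeSucc _ dendriform, treePrec, LinearMap.flip_apply,
      liftNode_eq_psiNode r, RBOps.toTri_prec_apply, LinearMap.comp_apply, shaIncl_tposIncl,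
      letter_mul_R, psiTree]
    exact treeSucc_eq_prependBracket l _
  | .cons l x t => by
    have dendriform := (shaOps_isRotaBaxter (tposBasis b) (1 : k)).toTri_isDendriform
    rw [liftNode, psiNode, treeSucc_dot _ dendriform, liftNode_eq_psiNode t,
      RBOps.toTri_dot_apply, one_smul, LinearMap.comp_apply, shaIncl_tposIncl,
      letter_of_mul_ofWord]
    exact treeSucc_eq_prependBracket l _
theorem treeSucc_eq_prependBracket : (T : Tree Ω) → ∀ z : Word (FreeSemigroup Ω) false,
    treeSucc ((shaOps (tposBasis b) 1).toTri 1)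
        (fun x => (shaIncl (tposBasis b) ∘ₗ tposIncl k V) (b x)) T (ofWord k z) =
      .single (prependBracket (psiTree T) z) 1
  | .leaf, z => by rw [treeSucc, psiTree, LinearMap.id_apply, prependBracket]
  | .node t, z => by
    rw [treeSucc, liftNode_eq_psiNode t, RBOps.toTri_succ_apply, R_mul_ofWord, psiTree]
end

theorem psi_eq_dtLift : psi k Ω = dtLift ((shaOps (tposBasis b) 1).toTri 1)
    fun x => (shaIncl (tposBasis b) ∘ₗ tposIncl k V) (b x) := by
  ext1 t
  ext1
  simpa [psi] using (liftNode_eq_psiNode b t).symm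

theorem psi_comp_dtIncl : psi k Ω ∘ₗ dtIncl b = shaIncl (tposBasis b) ∘ₗ tposIncl k V := by
  rw [psi_eq_dtLift b, dtLift_comp_dtIncl]

theorem psi_isHom : (dtOps k Ω).IsHom ((shaOps (tposBasis b) 1).toTri 1) (psi k Ω) := by
  rw [psi_eq_dtLift b]
  exact dtLift_isHom _ (shaOps_isRotaBaxter (tposBasis b) 1).toTri_isDendriform

theorem dtOps_isDendriform (k : Type*) [Field k] (Ω : Type*) : (dtOps k Ω).IsDendriform :=
  let b : Basis Ω k (Ω →₀ k) := Finsupp.basisSingleOne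
  (shaOps_isRotaBaxter (tposBasis b) 1).toTri_isDendriform.of_injective (psi_isHom b)
    (psi_injective k)

theorem dtOps_isFree : TriOps.IsFree.{w} (dtOps k Ω) (dtIncl b) := by
  refine ⟨dtOps_isDendriform k Ω, fun E _ _ o ho f => ?_⟩
  have hom := dtLift_isHom (k := k) (fun x => f (b x)) ho
  have hcomp := dtLift_comp_dtIncl b o f
  exact ⟨dtLift o fun x => f (b x), ⟨hom, hcomp⟩,
    fun g ⟨hg, hgf⟩ => dtOps_hom_ext b hg hom (hgf.trans hcomp.symm)⟩

end PsiHom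

end

end DendRB

theorem mainTheorem5 {k : Type*} [Field k] {V : Type*} [AddCommGroup V] [Module k V]
    {Ω : Type*} (b : Module.Basis Ω k V) :
    -- the trialgebra of decorated trees is the free dendriform trialgebra over `V`
    DendRB.TriOps.IsFree.{w} (DendRB.dtOps k Ω) (DendRB.dtIncl b) ∧
    -- `Ш(T(V))` is the free Rota-Baxter algebra of weight one over `T(V)`
    DendRB.RBOps.IsFree.{w} (DendRB.shaOps (DendRB.tposBasis b) 1) 1
      (DendRB.shaIncl (DendRB.tposBasis b)) ∧
    -- and its operations `≺_R`, `≻_R`, `·_R` make it a dendriform trialgebra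
    ((DendRB.shaOps (DendRB.tposBasis b) 1).toTri 1).IsDendriform ∧
    -- `ψ` is a morphism of dendriform trialgebras
    (DendRB.dtOps k Ω).IsHom ((DendRB.shaOps (DendRB.tposBasis b) 1).toTri 1)
      (DendRB.psi k Ω) ∧
    -- `ψ` is the one induced by the natural map `V → T(V) → Ш(T(V))`
    DendRB.psi k Ω ∘ₗ DendRB.dtIncl b =
      DendRB.shaIncl (DendRB.tposBasis b) ∘ₗ DendRB.tposIncl k V ∧
    (∀ g : DendRB.DT k Ω →ₗ[k] DendRB.Sha k (FreeSemigroup Ω),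
      (DendRB.dtOps k Ω).IsHom ((DendRB.shaOps (DendRB.tposBasis b) 1).toTri 1) g →
      g ∘ₗ DendRB.dtIncl b =
        DendRB.shaIncl (DendRB.tposBasis b) ∘ₗ DendRB.tposIncl k V →
      g = DendRB.psi k Ω) ∧
    -- the image of `ψ` is the span of the dendriform triwords
    LinearMap.range (DendRB.psi k Ω) = DendRB.triwordSpan k (FreeSemigroup Ω) ∧
    -- `ψ` is injective
    Function.Injective (DendRB.psi k Ω) := by
  have rotaBaxter := DendRB.shaOps_isRotaBaxter (DendRB.tposBasis b) (1 : k)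
  have hom := DendRB.psi_isHom b
  have hcomp := DendRB.psi_comp_dtIncl b
  exact ⟨DendRB.dtOps_isFree b, DendRB.shaOps_isFree _ _, rotaBaxter.toTri_isDendriform, hom, hcomp,
    fun g hg hgb => DendRB.dtOps_hom_ext b hg hom (hgb.trans hcomp.symm), DendRB.range_psi k,
    DendRB.psi_injective k⟩
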